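/- Let $R=\mathbb{Z}[t]/(t^3)$. A subring of $R$ is understood to contain $1$, and its index is its index as an additive subgroup. For a subring $S\subseteq R$ of finite index there are unique positive integers $\alpha_1,\alpha_2,\alpha_3$ with $\alpha_3\mid\alpha_2\mid\alpha_1$ and $R/S\cong \mathbb{Z}/\alpha_1\mathbb{Z}\oplus\mathbb{Z}/\alpha_2\mathbb{Z}\oplus\mathbb{Z}/\alpha_3\mathbb{Z}$ as abelian groups; the corank of $S$ is the largest $i$ with $\alpha_i\neq 1$ (and $0$ if there is none), and $S$ is called cocyclic if its corank is $0$ or $1$. For $n\ge 1$ let $a_n$ be the number of subrings of $R$ of index $n$, and $a_n^{\mathrm{cyclic}}$ the number of those that are cocyclic; these numbers are finite. Then the product $\prod_p(1-3p^{-2}+2p^{-3})$ over all primes $p$ converges, and \[ \sum_{n\le B} a_n^{\mathrm{cyclic}} \sim C\,B(\ln B)^2\quad (B\to\infty),\qquad C=\frac{1}{12}\prod_p\left(1-3p^{-2}+2p^{-3}\right). \] Moreover, the proportion of cocyclic subrings among all subrings satisfies \[ \lim_{B\to\infty}\frac{\sum_{n\le B} a_n^{\mathrm{cyclic}}}{\sum_{n\le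 B} a_n}=\zeta(2)\prod_p\left(1-3p^{-2}+2p^{-3}\right), \] where $\zeta$ is the Riemann zeta function. -/

import Mathlib

namespace CocyclicSubrings

/-- The ring `ℤ[t]/(t^3)`. -/
abbrev R : Type := Polynomial ℤ ⧸ Ideal.span {(Polynomial.X : Polynomial ℤ) ^ 3}

/-- `α = (α₁, …, αₙ)` is the cotype of the finite-index subgroup `Λ` of `A` (with `A` free abelian
of rank `n`): the `αᵢ` are positive integers, `αᵢ₊₁ ∣ αᵢ`, and
`A / Λ ≅ ℤ/α₁ ⊕ ⋯ ⊕ ℤ/αₙ`. The entry `αᵢ` is `α (i - 1)`, as `Fin n` starts at `0`. -/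
def IsCotype {A : Type*} [AddCommGroup A] {n : ℕ} (Λ : AddSubgroup A) (α : Fin n → ℕ) : Prop :=
  (∀ i, 0 < α i) ∧ (∀ i j, i ≤ j → α j ∣ α i) ∧ Nonempty ((A ⧸ Λ) ≃+ (∀ i, ZMod (α i)))

/-- The largest index `i ∈ {1, …, n}` with `αᵢ ≠ 1`, and `0` if there is none. -/
def corank {n : ℕ} (α : Fin n → ℕ) : ℕ :=
  (Finset.univ.filter fun i : Fin n => α i ≠ 1).sup fun i => (i : ℕ) + 1

/-- A (unital) subring of `ℤ[t]/(t^3)`, a free abelian group of rank `3`, is cocyclic if its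
additive group has finite index and corank `0` or `1`. -/
def IsCocyclic (S : Subring R) : Prop :=
  ∃ α : Fin 3 → ℕ, IsCotype S.toAddSubgroup α ∧ corank α ≤ 1

/-- The subrings of `ℤ[t]/(t^3)` of additive index `n` (meaningful for `n ≥ 1`;
Mathlib gives infinite index the value `0`). -/
def subringsOfIndex (n : ℕ) : Set (Subring R) :=
  {S | S.toAddSubgroup.index = n}

/-- The number of subrings of index `n`. -/
noncomputable def a (n : ℕ) : ℕ := (subringsOfIndex n).ncard

/-- The number of cocyclic subrings of index `n`. -/
noncomputable def aCyclic (n : ℕ) : ℕ := {S ∈ subringsOfIndex n | IsCocyclic S}.ncard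

/-- The number of subrings of index at most `B`. -/
noncomputable def N (B : ℝ) : ℕ := ∑ n ∈ Finset.Icc 1 ⌊B⌋₊, a n

/-- The number of cocyclic subrings of index at most `B`. -/
noncomputable def NCyclic (B : ℝ) : ℕ := ∑ n ∈ Finset.Icc 1 ⌊B⌋₊, aCyclic n

/-- The Euler factor `1 - 3 p⁻² + 2 p⁻³`. -/
noncomputable def eulerFactor (p : Nat.Primes) : ℝ :=
  1 - 3 * ((p : ℕ) : ℝ)⁻¹ ^ 2 + 2 * ((p : ℕ) : ℝ)⁻¹ ^ 3

end CocyclicSubrings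

/-! A subring contains ℤ, so a finite-index one is ℤ plus a lattice in ℤt + ℤt², with Hermite basis
at + bt², dt² and 0 ≤ b < d. Since (at + bt²)² = a²t², it is closed under products iff d ∣ a²; its
index is ad (`exists_eq_latticeSubring`, `index_latticeSubring`). It is cocyclic iff gcd(b, d) = 1
(`isCocyclic_latticeSubring`). So the counts at n are the sums of d, respectively φ(d), over ad = n
with d ∣ a².

Write d = rs² with r squarefree. Then d ∣ a² iff a = mrs, and n = mr²s³
(`sum_divisorsAntidiagonal_eq_weightedSum`). Summing over m leaves rs²⌊B/(r²s³)⌋, weighted by μ(r)²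
and, in the cocyclic case, by φ(d)/d = ∏_{p ∣ rs} (1 - 1/p). Without these arithmetic weights the
sum is about B ∑ 1/(rs) over r²s³ ≤ B, hence B times the area (log B)²/12 of the triangle 2u + 3v ≤
log B, u, v ≥ 0 (`weightedSum_one`).

The conditions at distinct primes are independent, p ∣ r and p ∣ s each having density 1/p, so
finitely many primes contribute the product of their mean values (`hasDensity_prod_localFactor`).
The remaining primes cost O(∑ p⁻²), uniformly in B (`weightedSum_prod_sub_sieveWeight`). The mean
value at p is 1 - 3p⁻² + 2p⁻³ for cocyclic subrings and 1 - p⁻² for all subrings, the latter with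
product 1/ζ(2). -/

namespace CocyclicSubrings

/-! ### Coordinates on `ℤ[t]/(t^3)` -/

/-- The coefficient of `t ^ i` in an element of `ℤ[t]/(t^3)`, for `i < 3`. -/
noncomputable def coord (i : Fin 3) : R →+ ℤ :=
  QuotientAddGroup.lift _ (Polynomial.lcoeff ℤ i).toAddMonoidHom <| by
    intro p hp
    have h : Polynomial.X ^ 3 ∣ p := Ideal.mem_span_singleton.1 hp
    exact Polynomial.X_pow_dvd_iff.1 h i i.2

/-- The element `x + y t + z t^2` of `ℤ[t]/(t^3)`. -/
noncomputable def elt (x y z : ℤ) : R :=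
  Ideal.Quotient.mk _ (Polynomial.C x + Polynomial.C y * Polynomial.X
    + Polynomial.C z * Polynomial.X ^ 2)

lemma coord_mk (i : Fin 3) (p : Polynomial ℤ) :
    coord i (Ideal.Quotient.mk _ p) = p.coeff i := rfl

@[simp] lemma coord_zero_elt (x y z : ℤ) : coord 0 (elt x y z) = x := by
  rw [elt, coord_mk]
  simp [-eq_intCast, Polynomial.coeff_X, Polynomial.coeff_X_pow, Polynomial.coeff_C]

@[simp] lemma coord_one_elt (x y z : ℤ) : coord 1 (elt x y z) = y := by
  rw [elt, coord_mk]
  simp [-eq_intCast, Polynomial.coeff_X_pow, Polynomial.coeff_C]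

@[simp] lemma coord_two_elt (x y z : ℤ) : coord 2 (elt x y z) = z := by
  rw [elt, coord_mk]
  simp [-eq_intCast, Polynomial.coeff_X_pow]

lemma ext_coord {x y : R} (h0 : coord 0 x = coord 0 y) (h1 : coord 1 x = coord 1 y)
    (h2 : coord 2 x = coord 2 y) : x = y := by
  obtain ⟨p, rfl⟩ := Ideal.Quotient.mk_surjective x
  obtain ⟨q, rfl⟩ := Ideal.Quotient.mk_surjective y
  rw [Ideal.Quotient.eq, Ideal.mem_span_singleton, Polynomial.X_pow_dvd_iff]
  intro d hd
  rw [coord_mk, coord_mk] at h0 h1 h2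
  rw [Polynomial.coeff_sub, sub_eq_zero]
  interval_cases d
  exacts [h0, h1, h2]

lemma coord_zero_mul (x y : R) : coord 0 (x * y) = coord 0 x * coord 0 y := by
  obtain ⟨p, rfl⟩ := Ideal.Quotient.mk_surjective x
  obtain ⟨q, rfl⟩ := Ideal.Quotient.mk_surjective y
  rw [← map_mul, coord_mk]
  exact Polynomial.mul_coeff_zero p q

lemma coord_one_mul (x y : R) :
    coord 1 (x * y) = coord 0 x * coord 1 y + coord 1 x * coord 0 y := by
  obtain ⟨p, rfl⟩ := Ideal.Quotient.mk_surjective x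
  obtain ⟨q, rfl⟩ := Ideal.Quotient.mk_surjective y
  rw [← map_mul, coord_mk]
  exact Polynomial.mul_coeff_one p q

lemma coord_two_mul (x y : R) :
    coord 2 (x * y) = coord 0 x * coord 2 y + coord 1 x * coord 1 y + coord 2 x * coord 0 y := by
  obtain ⟨p, rfl⟩ := Ideal.Quotient.mk_surjective x
  obtain ⟨q, rfl⟩ := Ideal.Quotient.mk_surjective y
  rw [← map_mul]
  simp only [coord_mk, Polynomial.coeff_mul, Fin.val_two, Fin.val_one, Fin.val_zero]
  rw [Finset.Nat.sum_antidiagonal_eq_sum_range_succ fun i j => p.coeff i * q.coeff j]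
  simp [Finset.sum_range_succ]

@[simp] lemma coord_zero_one : coord 0 (1 : R) = 1 := by
  rw [← map_one (Ideal.Quotient.mk _), coord_mk]; simp

@[simp] lemma coord_one_one : coord 1 (1 : R) = 0 := by
  rw [← map_one (Ideal.Quotient.mk _), coord_mk]; simp [Polynomial.coeff_one]

@[simp] lemma coord_two_one : coord 2 (1 : R) = 0 := by
  rw [← map_one (Ideal.Quotient.mk _), coord_mk]; simp [Polynomial.coeff_one]

/-! ### Classification of the subrings of finite index -/

/-- The subring `ℤ + ℤ (a t + b t^2) + ℤ d t^2`, where `d ∣ a^2`. -/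
noncomputable def latticeSubring (a b d : ℕ) (h : d ∣ a ^ 2) : Subring R where
  carrier := {x | ∃ k l : ℤ, coord 1 x = a * k ∧ coord 2 x = b * k + d * l}
  zero_mem' := ⟨0, 0, by simp, by simp⟩
  one_mem' := ⟨0, 0, by simp, by simp⟩
  add_mem' := by
    rintro x y ⟨k, l, h1, h2⟩ ⟨k', l', h1', h2'⟩
    exact ⟨k + k', l + l', by rw [map_add, h1, h1']; ring, by rw [map_add, h2, h2']; ring⟩
  neg_mem' := by
    rintro x ⟨k, l, h1, h2⟩
    exact ⟨-k, -l, by rw [map_neg, h1]; ring, by rw [map_neg, h2]; ring⟩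
  mul_mem' := by
    rintro x y ⟨k, l, h1, h2⟩ ⟨k', l', h1', h2'⟩
    obtain ⟨e, he⟩ := h
    have he' : (a : ℤ) ^ 2 = d * e := by exact_mod_cast he
    refine ⟨coord 0 x * k' + coord 0 y * k, coord 0 x * l' + coord 0 y * l + e * k * k', ?_, ?_⟩
    · rw [coord_one_mul, h1, h1']; ring
    · rw [coord_two_mul, h1, h1', h2, h2']
      linear_combination k * k' * he'

lemma mem_latticeSubring {a b d : ℕ} {h : d ∣ a ^ 2} {x : R} :
    x ∈ latticeSubring a b d h ↔
      ∃ k l : ℤ, coord 1 x = a * k ∧ coord 2 x = b * k + d * l := Iff.rfl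

/-- The index is found in two stages: y mod a has a kernel of index a, and inside it the subring is
the kernel of z - b(y/a) mod d, where y and z are the coefficients of t and t². -/
lemma index_latticeSubring {a b d : ℕ} (h : d ∣ a ^ 2) (ha : 0 < a) (hd : 0 < d) :
    (latticeSubring a b d h).toAddSubgroup.index = a * d := by
  have := NeZero.of_pos ha
  have := NeZero.of_pos hd
  have ha' : (a : ℤ) ≠ 0 := by exact_mod_cast ha.ne'
  let f : R →+ ZMod a := (Int.castAddHom (ZMod a)).comp (coord 1)
  have hf : Function.Surjective f := fun z => by
    obtain ⟨y, rfl⟩ := ZMod.intCast_surjective z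
    exact ⟨elt 0 y 0, by simp [f]⟩
  have hfk : ∀ x, x ∈ f.ker ↔ (a : ℤ) ∣ coord 1 x := fun x => by
    rw [AddMonoidHom.mem_ker]; exact ZMod.intCast_zmod_eq_zero_iff_dvd _ _
  have hfi : f.ker.index = a := by
    rw [AddSubgroup.index_ker, AddMonoidHom.range_eq_top.2 hf]
    simp
  let g : f.ker →+ ZMod d :=
    { toFun := fun x => ((coord 2 (x : R) - b * (coord 1 (x : R) / a) : ℤ) : ZMod d)
      map_zero' := by simp
      map_add' := by
        rintro ⟨x, hx⟩ ⟨y, hy⟩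
        rw [hfk] at hx hy
        simp only [AddSubgroup.coe_add, map_add, Int.add_ediv_of_dvd_left hx]
        push_cast; ring }
  have hg : Function.Surjective g := fun z => by
    obtain ⟨y, rfl⟩ := ZMod.intCast_surjective z
    exact ⟨⟨elt 0 0 y, by rw [hfk]; simp⟩, by simp [g]⟩
  have hgi : g.ker.index = d := by
    rw [AddSubgroup.index_ker, AddMonoidHom.range_eq_top.2 hg]
    simp
  have hgk : (latticeSubring a b d h).toAddSubgroup.addSubgroupOf f.ker = g.ker := by
    ext ⟨x, hx⟩
    have hx' := hx
    rw [hfk] at hx'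
    obtain ⟨k, hk⟩ := hx'
    rw [AddSubgroup.mem_addSubgroupOf, AddMonoidHom.mem_ker]
    change (∃ k l : ℤ, coord 1 x = a * k ∧ coord 2 x = b * k + d * l) ↔
      ((coord 2 x - b * (coord 1 x / a) : ℤ) : ZMod d) = 0
    rw [ZMod.intCast_zmod_eq_zero_iff_dvd, hk, Int.mul_ediv_cancel_left _ ha']
    constructor
    · rintro ⟨k', l, h1, h2⟩
      obtain rfl := mul_left_cancel₀ ha' h1
      exact ⟨l, by rw [h2]; ring⟩
    · rintro ⟨l, hl⟩
      exact ⟨k, l, rfl, by rw [← hl]; ring⟩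
  have hle : (latticeSubring a b d h).toAddSubgroup ≤ f.ker := by
    rintro x ⟨k, l, h1, -⟩
    rw [hfk]; exact ⟨k, h1⟩
  rw [← AddSubgroup.relIndex_mul_index hle, hfi, AddSubgroup.relIndex, hgk, hgi, mul_comm]

/-- The subring determines a as the generator of its t-coefficients, d through its intersection with
ℤt², and then b modulo d. -/
lemma latticeSubring_inj {a b d a' b' d' : ℕ} {h : d ∣ a ^ 2} {h' : d' ∣ a' ^ 2}
    (ha : 0 < a) (hb : b < d) (hb' : b' < d')
    (heq : latticeSubring a b d h = latticeSubring a' b' d' h') : a = a' ∧ b = b' ∧ d = d' := by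
  have key : ∀ {a b d a' b' d' : ℕ} {h : d ∣ a ^ 2} {h' : d' ∣ a' ^ 2},
      latticeSubring a b d h = latticeSubring a' b' d' h' → a' ∣ a ∧ (0 < a' → d' ∣ d) := by
    intro a b d a' b' d' h h' heq
    constructor
    · have : elt 0 a b ∈ latticeSubring a' b' d' h' := by
        rw [← heq]; exact ⟨1, 0, by simp, by simp⟩
      obtain ⟨k, l, h1, -⟩ := this
      rw [coord_one_elt] at h1
      exact Int.natCast_dvd_natCast.1 ⟨k, h1⟩
    · intro ha'
      have : elt 0 0 d ∈ latticeSubring a' b' d' h' := by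
        rw [← heq]; exact ⟨0, 1, by simp, by simp⟩
      obtain ⟨k, l, h1, h2⟩ := this
      rw [coord_one_elt] at h1
      rw [coord_two_elt] at h2
      have : k = 0 := by
        rcases mul_eq_zero.1 h1.symm with h | h
        · exact absurd (by exact_mod_cast h) ha'.ne'
        · exact h
      subst this
      exact Int.natCast_dvd_natCast.1 ⟨l, by rw [h2]; ring⟩
  have haa : a = a' := Nat.dvd_antisymm (key heq.symm).1 (key heq).1
  have hdd : d = d' :=
    Nat.dvd_antisymm ((key heq.symm).2 ha) ((key heq).2 (haa ▸ ha))
  subst haa hdd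
  refine ⟨rfl, ?_, rfl⟩
  have : elt 0 a b ∈ latticeSubring a b' d h' := by
    rw [← heq]; exact ⟨1, 0, by simp, by simp⟩
  obtain ⟨k, l, h1, h2⟩ := this
  rw [coord_one_elt] at h1
  rw [coord_two_elt] at h2
  have hk : k = 1 := by
    have ha' : (a : ℤ) ≠ 0 := by exact_mod_cast ha.ne'
    exact mul_left_cancel₀ ha' (by rw [← h1, mul_one])
  subst hk
  have hm : b' ≡ b [MOD d] := by
    rw [Nat.modEq_iff_dvd]
    exact ⟨l, by rw [h2]; ring⟩
  exact (Nat.ModEq.eq_of_lt_of_lt hm hb' hb).symm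

lemma exists_eq_latticeSubring (S : Subring R) (hS : S.toAddSubgroup.index ≠ 0) :
    ∃ (a b d : ℕ) (h : d ∣ a ^ 2), 0 < a ∧ b < d ∧ S = latticeSubring a b d h := by
  set n := S.toAddSubgroup.index with hn
  have hn' : (n : ℤ) ≠ 0 := by exact_mod_cast hS
  -- Multiples of the index lie in `S`; this is what makes both a and d nonzero.
  have hmul : ∀ x : R, n • x ∈ S := fun x =>
    AddSubgroup.nsmul_index_mem S.toAddSubgroup x
  have hint : ∀ z : ℤ, elt z 0 0 ∈ S := fun z => by
    have h : elt z 0 0 = (z : R) := by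
      rw [← zsmul_one]
      apply ext_coord <;> rw [map_zsmul] <;> simp
    rw [h]; exact intCast_mem S z
  have hred : ∀ x ∈ S, elt 0 (coord 1 x) (coord 2 x) ∈ S := fun x hx => by
    have h : elt 0 (coord 1 x) (coord 2 x) = x - elt (coord 0 x) 0 0 := by
      apply ext_coord <;> rw [map_sub] <;> simp
    rw [h]; exact S.sub_mem hx (hint _)
  obtain ⟨a, ha⟩ : ∃ a : ℕ, ∀ z : ℤ, z ∈ S.toAddSubgroup.map (coord 1) ↔ (a : ℤ) ∣ z := by
    obtain ⟨g, hg⟩ := Int.subgroup_cyclic (S.toAddSubgroup.map (coord 1))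
    refine ⟨g.natAbs, fun z => ?_⟩
    rw [hg, AddSubgroup.mem_closure_singleton, Int.natAbs_dvd]
    exact ⟨fun ⟨k, hk⟩ => ⟨k, by rw [← hk, smul_eq_mul, mul_comm]⟩,
      fun ⟨k, hk⟩ => ⟨k, by rw [hk, smul_eq_mul, mul_comm]⟩⟩
  let ι : ℤ →+ R := AddMonoidHom.mk' (fun z => elt 0 0 z) fun x y => by
    apply ext_coord <;> rw [map_add] <;> simp
  obtain ⟨d, hd⟩ : ∃ d : ℕ, ∀ z : ℤ, elt 0 0 z ∈ S ↔ (d : ℤ) ∣ z := by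
    obtain ⟨g, hg⟩ := Int.subgroup_cyclic (S.toAddSubgroup.comap ι)
    refine ⟨g.natAbs, fun z => ?_⟩
    have : elt 0 0 z ∈ S ↔ z ∈ S.toAddSubgroup.comap ι := Iff.rfl
    rw [this, hg, AddSubgroup.mem_closure_singleton, Int.natAbs_dvd]
    exact ⟨fun ⟨k, hk⟩ => ⟨k, by rw [← hk, smul_eq_mul, mul_comm]⟩,
      fun ⟨k, hk⟩ => ⟨k, by rw [hk, smul_eq_mul, mul_comm]⟩⟩
  have ha0 : 0 < a := by
    rcases Nat.eq_zero_or_pos a with h | h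
    · have := (ha n).1 ⟨n • elt 0 1 0, hmul _, by rw [map_nsmul]; simp⟩
      rw [h] at this
      exact absurd (by simpa using this) hS
    · exact h
  have hd0 : 0 < d := by
    rcases Nat.eq_zero_or_pos d with h | h
    · have h1 : elt 0 0 n ∈ S := by
        have : elt 0 0 n = n • elt 0 0 1 := by
          apply ext_coord <;> rw [map_nsmul] <;> simp
        rw [this]; exact hmul _
      have := (hd n).1 h1
      rw [h] at this
      exact absurd (by simpa using this) hS
    · exact h
  obtain ⟨x, hx, hxa⟩ := (ha a).2 dvd_rfl
  have hx1 := hred x hx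
  rw [hxa] at hx1
  have hd0' : (d : ℤ) ≠ 0 := by exact_mod_cast hd0.ne'
  set b : ℕ := (coord 2 x % d).toNat with hb
  have hbz : (b : ℤ) = coord 2 x % d := Int.toNat_of_nonneg (Int.emod_nonneg _ hd0')
  have hbd : b < d := by
    have := Int.emod_lt_of_pos (coord 2 x) (by exact_mod_cast hd0 : (0 : ℤ) < d)
    rw [← hbz] at this; exact_mod_cast this
  have hab : elt 0 a b ∈ S := by
    have h1 : elt 0 a b = elt 0 a (coord 2 x) - elt 0 0 (d * (coord 2 x / d)) := by
      apply ext_coord <;> rw [map_sub] <;> simp only [coord_zero_elt, coord_one_elt, coord_two_elt]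
      · simp
      · simp
      · rw [hbz, Int.emod_def]
    rw [h1]
    exact S.sub_mem hx1 ((hd _).2 (dvd_mul_right _ _))
  have hda : d ∣ a ^ 2 := by
    have h1 : elt 0 a b * elt 0 a b = elt 0 0 ((a : ℤ) ^ 2) := by
      apply ext_coord
      · rw [coord_zero_mul]; simp
      · rw [coord_one_mul]; simp
      · rw [coord_two_mul]; simp [sq]
    have h2 := (hd _).1 (h1 ▸ S.mul_mem hab hab)
    exact_mod_cast h2
  have hcomb : ∀ k l : ℤ, elt 0 (a * k) (b * k + d * l) ∈ S := fun k l => by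
    have h1 : elt 0 (a * k) (b * k + d * l) = k • elt 0 a b + elt 0 0 (d * l) := by
      apply ext_coord <;> rw [map_add, map_zsmul] <;> simp [mul_comm]
    rw [h1]
    exact S.add_mem (S.zsmul_mem hab k) ((hd _).2 (dvd_mul_right _ _))
  refine ⟨a, b, d, hda, ha0, hbd, ?_⟩
  ext y
  rw [mem_latticeSubring]
  constructor
  · intro hy
    obtain ⟨k, hk⟩ := (ha _).1 ⟨y, hy, rfl⟩
    have h1 : elt 0 0 (coord 2 y - b * k) ∈ S := by
      have h2 : elt 0 0 (coord 2 y - b * k) =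
          elt 0 (coord 1 y) (coord 2 y) - elt 0 (a * k) (b * k + d * 0) := by
        apply ext_coord <;> rw [map_sub] <;> simp [hk]
      rw [h2]; exact S.sub_mem (hred y hy) (hcomb k 0)
    obtain ⟨l, hl⟩ := (hd _).1 h1
    exact ⟨k, l, hk, by rw [← hl]; ring⟩
  · rintro ⟨k, l, h1, h2⟩
    have h3 : y = elt (coord 0 y) 0 0 + elt 0 (a * k) (b * k + d * l) := by
      apply ext_coord <;> rw [map_add] <;> simp [h1, h2]
    rw [h3]; exact S.add_mem (hint _) (hcomb k l)

/-! ### Cocyclic subrings -/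

/-- Corank at most 1 leaves only ℤ/α₁ in the decomposition, so the condition says that the quotient
is cyclic; g lifts a generator. -/
lemma isCocyclic_iff (S : Subring R) (hS : S.toAddSubgroup.index ≠ 0) :
    IsCocyclic S ↔ ∃ g : R, ∀ x : R, ∃ k : ℤ, x - k • g ∈ S := by
  have key : (∃ g : R, ∀ x : R, ∃ k : ℤ, x - k • g ∈ S) ↔
      IsAddCyclic (R ⧸ S.toAddSubgroup) := by
    constructor
    · rintro ⟨g, hg⟩
      refine ⟨⟨(g : R ⧸ S.toAddSubgroup), fun x => ?_⟩⟩
      obtain ⟨x, rfl⟩ := QuotientAddGroup.mk_surjective x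
      obtain ⟨k, hk⟩ := hg x
      refine ⟨k, ?_⟩
      change k • (g : R ⧸ S.toAddSubgroup) = x
      rw [← QuotientAddGroup.mk_zsmul, QuotientAddGroup.eq, neg_add_eq_sub]
      exact hk
    · rintro ⟨⟨g, hg⟩⟩
      obtain ⟨g, rfl⟩ := QuotientAddGroup.mk_surjective g
      refine ⟨g, fun x => ?_⟩
      obtain ⟨k, hk⟩ := hg x
      change k • (g : R ⧸ S.toAddSubgroup) = x at hk
      rw [← QuotientAddGroup.mk_zsmul, QuotientAddGroup.eq, neg_add_eq_sub] at hk
      exact ⟨k, hk⟩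
  rw [key]
  constructor
  · rintro ⟨α, ⟨-, -, ⟨e⟩⟩, hc⟩
    have h1 : ∀ i : Fin 3, i ≠ 0 → α i = 1 := by
      intro i hi
      by_contra h
      have : (i : ℕ) + 1 ≤ 1 := le_trans (Finset.le_sup (f := fun i : Fin 3 => (i : ℕ) + 1)
        (Finset.mem_filter.2 ⟨Finset.mem_univ i, h⟩)) hc
      exact hi (Fin.ext (by simpa using this))
    have hinj : Function.Injective (Pi.evalAddMonoidHom (fun i => ZMod (α i)) 0) := by
      intro x y hxy
      funext i
      by_cases hi : i = 0
      · subst hi; exact hxy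
      · have : Subsingleton (ZMod (α i)) := by rw [h1 i hi]; infer_instance
        exact Subsingleton.elim _ _
    have hcyc := isAddCyclic_of_injective
      ((Pi.evalAddMonoidHom (fun i => ZMod (α i)) 0).comp e.toAddMonoidHom)
      (hinj.comp e.injective)
    exact hcyc
  · intro hcyc
    have hcard : Nat.card (R ⧸ S.toAddSubgroup) = S.toAddSubgroup.index := rfl
    set n := S.toAddSubgroup.index
    let e : ZMod n ≃+ R ⧸ S.toAddSubgroup := hcard ▸ zmodAddCyclicAddEquiv hcyc
    let α : Fin 3 → ℕ := fun i => if i = 0 then n else 1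
    have hα : ∀ i : Fin 3, i ≠ 0 → α i = 1 := fun i hi => if_neg hi
    have hsub : ∀ i : Fin 3, i ≠ 0 → Subsingleton (ZMod (α i)) := fun i hi => by
      rw [hα i hi]; infer_instance
    have hbij : Function.Bijective (Pi.evalAddMonoidHom (fun i => ZMod (α i)) 0) := by
      refine ⟨fun x y hxy => ?_, fun z => ⟨Pi.single 0 z, by simp⟩⟩
      funext i
      by_cases hi : i = 0
      · subst hi; exact hxy
      · have := hsub i hi
        exact Subsingleton.elim _ _
    refine ⟨α, ⟨?_, ?_, ⟨?_⟩⟩, ?_⟩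
    · intro i
      by_cases hi : i = 0
      · subst hi; exact Nat.pos_of_ne_zero hS
      · rw [hα i hi]; exact one_pos
    · intro i j hij
      by_cases hj : j = 0
      · subst hj
        rw [Fin.le_zero_iff.1 hij]
      · rw [hα j hj]; exact one_dvd _
    · exact e.symm.trans (AddEquiv.ofBijective _ hbij).symm
    · refine Finset.sup_le fun i hi => ?_
      have hi' := (Finset.mem_filter.1 hi).2
      by_cases h : i = 0
      · subst h; simp
      · exact absurd (hα i h) hi'

/-- A prime p dividing b and d also divides a, so the quotient maps onto (ℤ/p)², which is not
cyclic. Conversely, if ub + vd = 1, then t² ≡ -uat modulo the subring, and t generates the quotient.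
-/
lemma isCocyclic_latticeSubring {a b d : ℕ} (h : d ∣ a ^ 2) (ha : 0 < a) (hd : 0 < d) :
    IsCocyclic (latticeSubring a b d h) ↔ d.Coprime b := by
  rw [isCocyclic_iff _ (by rw [index_latticeSubring h ha hd]; positivity)]
  constructor
  · rintro ⟨g, hg⟩
    refine Nat.Coprime.symm (Nat.coprime_of_dvd fun p hp hpb hpd => ?_)
    have hpa : p ∣ a := hp.dvd_of_dvd_pow (hpd.trans h)
    have hS : ∀ x ∈ latticeSubring a b d h, (p : ℤ) ∣ coord 1 x ∧ (p : ℤ) ∣ coord 2 x := by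
      rintro x ⟨k, l, h1, h2⟩
      have ha' : (p : ℤ) ∣ a := Int.natCast_dvd_natCast.2 hpa
      have hb' : (p : ℤ) ∣ b := Int.natCast_dvd_natCast.2 hpb
      have hd' : (p : ℤ) ∣ d := Int.natCast_dvd_natCast.2 hpd
      exact ⟨h1 ▸ ha'.mul_right _, h2 ▸ (hb'.mul_right _).add (hd'.mul_right _)⟩
    obtain ⟨k, hk⟩ := hg (elt 0 1 0)
    obtain ⟨l, hl⟩ := hg (elt 0 0 1)
    obtain ⟨h1, h2⟩ := hS _ hk
    obtain ⟨h3, h4⟩ := hS _ hl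
    simp only [map_sub, map_zsmul, coord_one_elt, coord_two_elt, smul_eq_mul] at h1 h2 h3 h4
    -- Modulo p the rank-one matrix (k, l)ᵀ(g₁, g₂) would be the identity; the identity below
    -- expresses that its determinant vanishes.
    have h5 : (p : ℤ) ∣ 1 := by
      have : (1 : ℤ) = (1 - k * coord 1 g) * (1 - l * coord 2 g)
          + (1 - k * coord 1 g) * (l * coord 2 g) + (0 - l * coord 1 g) * (0 - k * coord 2 g)
          + (1 - l * coord 2 g) * (k * coord 1 g) := by ring
      rw [this]
      exact (((h1.mul_right _).add (h1.mul_right _)).add (h3.mul_right _)).add (h4.mul_right _)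
    exact hp.one_lt.ne' (by exact_mod_cast Int.eq_one_of_dvd_one (by positivity) h5)
  · intro hc
    obtain ⟨u, v, huv⟩ : IsCoprime (b : ℤ) d := Nat.isCoprime_iff_coprime.2 hc.symm
    refine ⟨elt 0 1 0, fun x => ⟨coord 1 x - u * a * coord 2 x, u * coord 2 x, v * coord 2 x,
      ?_, ?_⟩⟩
    · simp only [map_sub, map_zsmul, coord_one_elt, smul_eq_mul]; ring
    · simp only [map_sub, map_zsmul, coord_two_elt, smul_eq_mul]
      linear_combination - coord 2 x * huv

/-! ### Counting formulas -/

/-- The parameters `((a, d), b)` of the subrings of index `n`. -/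
def params (n : ℕ) : Finset ((_ : ℕ × ℕ) × ℕ) :=
  (n.divisorsAntidiagonal.filter fun x => x.2 ∣ x.1 ^ 2).sigma fun x => Finset.range x.2

/-- The subring with parameters `((a, d), b)`. -/
noncomputable def ofParams (x : (_ : ℕ × ℕ) × ℕ) : Subring R :=
  if h : x.1.2 ∣ x.1.1 ^ 2 then latticeSubring x.1.1 x.2 x.1.2 h else ⊤

lemma mem_params {n : ℕ} {x : (_ : ℕ × ℕ) × ℕ} :
    x ∈ params n ↔ (x.1.1 * x.1.2 = n ∧ n ≠ 0) ∧ x.1.2 ∣ x.1.1 ^ 2 ∧ x.2 < x.1.2 := by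
  simp [params, and_assoc]

lemma bijOn_ofParams {n : ℕ} (hn : n ≠ 0) :
    Set.BijOn ofParams (params n) (subringsOfIndex n) := by
  refine ⟨fun x hx => ?_, fun x hx y hy hxy => ?_, fun S hS => ?_⟩
  · obtain ⟨⟨h1, -⟩, h2, h3⟩ := mem_params.1 hx
    have ha : 0 < x.1.1 := Nat.pos_of_ne_zero fun h => hn (by rw [← h1, h, zero_mul])
    rw [ofParams, dif_pos h2]
    exact (index_latticeSubring h2 ha (by omega)).trans h1
  · obtain ⟨⟨h1, -⟩, h2, h3⟩ := mem_params.1 hx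
    obtain ⟨⟨h1', -⟩, h2', h3'⟩ := mem_params.1 hy
    have ha : 0 < x.1.1 := Nat.pos_of_ne_zero fun h => hn (by rw [← h1, h, zero_mul])
    rw [ofParams, ofParams, dif_pos h2, dif_pos h2'] at hxy
    obtain ⟨e1, e2, e3⟩ := latticeSubring_inj ha h3 h3' hxy
    obtain ⟨⟨a, d⟩, b⟩ := x
    obtain ⟨⟨a', d'⟩, b'⟩ := y
    simp only at e1 e2 e3
    subst e1 e2 e3
    rfl
  · have hS' : S.toAddSubgroup.index = n := hS
    obtain ⟨a, b, d, h, ha, hb, rfl⟩ := exists_eq_latticeSubring S (hS' ▸ hn)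
    rw [index_latticeSubring h ha (by omega)] at hS'
    refine ⟨⟨(a, d), b⟩, mem_params.2 ⟨⟨hS', hn⟩, h, hb⟩, ?_⟩
    rw [ofParams, dif_pos h]

lemma finite_subringsOfIndex {n : ℕ} (hn : n ≠ 0) : (subringsOfIndex n).Finite := by
  rw [← (bijOn_ofParams hn).image_eq]
  exact (params n).finite_toSet.image _

lemma a_eq_sum {n : ℕ} (hn : n ≠ 0) :
    a n = ∑ x ∈ n.divisorsAntidiagonal with x.2 ∣ x.1 ^ 2, x.2 := by
  rw [a, ← (bijOn_ofParams hn).image_eq, (bijOn_ofParams hn).injOn.ncard_image,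
    Set.ncard_coe_finset, params, Finset.card_sigma]
  simp

lemma aCyclic_eq_sum {n : ℕ} (hn : n ≠ 0) :
    aCyclic n = ∑ x ∈ n.divisorsAntidiagonal with x.2 ∣ x.1 ^ 2, x.2.totient := by
  have hset : {S ∈ subringsOfIndex n | IsCocyclic S} =
      ofParams '' ((params n).filter fun x => x.1.2.Coprime x.2) := by
    ext S
    rw [← (bijOn_ofParams hn).image_eq]
    have key : ∀ x ∈ params n, (IsCocyclic (ofParams x) ↔ x.1.2.Coprime x.2) := fun x hx => by
      obtain ⟨⟨h1, -⟩, h2, h3⟩ := mem_params.1 hx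
      have ha : 0 < x.1.1 := Nat.pos_of_ne_zero fun h => hn (by rw [← h1, h, zero_mul])
      rw [ofParams, dif_pos h2]
      exact isCocyclic_latticeSubring h2 ha (by omega)
    constructor
    · rintro ⟨⟨x, hx, rfl⟩, hc⟩
      exact ⟨x, by simpa using ⟨hx, (key x hx).1 hc⟩, rfl⟩
    · rintro ⟨x, hx, rfl⟩
      obtain ⟨hx, hc⟩ := Finset.mem_filter.1 hx
      exact ⟨⟨x, hx, rfl⟩, (key x hx).2 hc⟩
  have hinj : Set.InjOn ofParams ((params n).filter fun x => x.1.2.Coprime x.2) :=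
    (bijOn_ofParams hn).injOn.mono fun x hx => (Finset.mem_filter.1 hx).1
  rw [aCyclic, hset, hinj.ncard_image, Set.ncard_coe_finset, params,
    Finset.card_filter, Finset.sum_sigma]
  refine Finset.sum_congr rfl fun x _ => ?_
  rw [Nat.totient, Finset.card_filter]

/-! ### Weighted sums over pairs -/

/-- The number of `m ≥ 1` with `m r^2 s^3 ≤ B`, weighted by `r s^2`, at `x = (r, s)`. -/
noncomputable def weight (B : ℝ) (x : ℕ × ℕ) : ℝ :=
  x.1 * x.2 ^ 2 * ⌊B / (x.1 ^ 2 * x.2 ^ 3)⌋₊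

/-- The sum of `F (r, s)` over all `(r, s)`, weighted by `weight B`. -/
noncomputable def weightedSum (F : ℕ × ℕ → ℝ) (B : ℝ) : ℝ := ∑' x, F x * weight B x

lemma weight_nonneg (B : ℝ) (x : ℕ × ℕ) : 0 ≤ weight B x := by unfold weight; positivity

lemma of_weight_ne_zero {B : ℝ} {x : ℕ × ℕ} (h : weight B x ≠ 0) :
    0 < x.1 ∧ 0 < x.2 ∧ (x.1 ^ 2 * x.2 ^ 3 : ℝ) ≤ B := by
  obtain ⟨r, s⟩ := x
  simp only [weight, ne_eq, mul_eq_zero, not_or, Nat.cast_eq_zero] at h ⊢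
  obtain ⟨⟨hr, hs⟩, hB⟩ := h
  have hr' : 0 < r := Nat.pos_of_ne_zero hr
  have hs' : 0 < s := Nat.pos_of_ne_zero fun h => hs (by simp [h])
  refine ⟨hr', hs', ?_⟩
  have h1 := Nat.floor_pos.1 (Nat.pos_of_ne_zero hB)
  rwa [one_le_div (by positivity)] at h1

lemma support_weight_subset (B : ℝ) :
    Function.support (weight B) ⊆ (Finset.Icc 1 ⌊B⌋₊ ×ˢ Finset.Icc 1 ⌊B⌋₊ : Finset (ℕ × ℕ)) := by
  intro x hx
  obtain ⟨h1, h2, h3⟩ := of_weight_ne_zero hx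
  have h1' : (1 : ℝ) ≤ x.1 := by exact_mod_cast h1
  have h2' : (1 : ℝ) ≤ x.2 := by exact_mod_cast h2
  have h4 : (1 : ℝ) ≤ x.1 ^ 2 := one_le_pow₀ h1'
  have h5 : (1 : ℝ) ≤ x.2 ^ 3 := one_le_pow₀ h2'
  have h6 : (x.1 : ℝ) ≤ x.1 ^ 2 := le_self_pow₀ h1' (by norm_num)
  have h7 : (x.2 : ℝ) ≤ x.2 ^ 3 := le_self_pow₀ h2' (by norm_num)
  simp only [Finset.coe_product, Finset.coe_Icc, Set.mem_prod, Set.mem_Icc]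
  exact ⟨⟨h1, Nat.le_floor (by nlinarith)⟩, h2, Nat.le_floor (by nlinarith)⟩

lemma support_mul_weight_subset (F : ℕ × ℕ → ℝ) (B : ℝ) :
    Function.support (fun x => F x * weight B x) ⊆
      (Finset.Icc 1 ⌊B⌋₊ ×ˢ Finset.Icc 1 ⌊B⌋₊ : Finset (ℕ × ℕ)) :=
  fun _ hx => support_weight_subset B (right_ne_zero_of_mul hx)

/-- An infinite sum allows substitutions r ↦ kr without tracking ranges; this finite form serves for
estimates. -/
lemma weightedSum_eq_sum (F : ℕ × ℕ → ℝ) (B : ℝ) :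
    weightedSum F B = ∑ x ∈ Finset.Icc 1 ⌊B⌋₊ ×ˢ Finset.Icc 1 ⌊B⌋₊, F x * weight B x :=
  tsum_eq_sum' (support_mul_weight_subset F B)

lemma summable_mul_weight (F : ℕ × ℕ → ℝ) (B : ℝ) : Summable fun x => F x * weight B x :=
  summable_of_hasFiniteSupport ((Finset.finite_toSet _).subset (support_mul_weight_subset F B))

/-! ### The unweighted asymptotics -/

lemma sum_inv_Icc_mem {x : ℝ} (hx : 1 ≤ x) :
    Real.log x ≤ ∑ r ∈ Finset.Icc 1 ⌊x⌋₊, (r : ℝ)⁻¹ ∧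
      ∑ r ∈ Finset.Icc 1 ⌊x⌋₊, (r : ℝ)⁻¹ ≤ 1 + Real.log x := by
  have h : ((harmonic ⌊x⌋₊ : ℚ) : ℝ) = ∑ r ∈ Finset.Icc 1 ⌊x⌋₊, (r : ℝ)⁻¹ := by
    rw [harmonic_eq_sum_Icc]; push_cast; rfl
  rw [← h]
  exact ⟨log_le_harmonic_floor x (by linarith), harmonic_floor_le_one_add_log x hx⟩

/-- Dropping the floor costs at most r ≤ x in each of at most x terms; the harmonic sum does the
rest. -/
lemma sum_mul_floor_sq {x : ℝ} (hx : 1 ≤ x) :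
    |∑ r ∈ Finset.Icc 1 ⌊x⌋₊, (r : ℝ) * ⌊x ^ 2 / r ^ 2⌋₊ - x ^ 2 * Real.log x| ≤ x ^ 2 := by
  obtain ⟨h1, h2⟩ := sum_inv_Icc_mem hx
  have hx0 : 0 ≤ x := by linarith
  have hup : ∑ r ∈ Finset.Icc 1 ⌊x⌋₊, (r : ℝ) * ⌊x ^ 2 / r ^ 2⌋₊
      ≤ x ^ 2 * ∑ r ∈ Finset.Icc 1 ⌊x⌋₊, (r : ℝ)⁻¹ := by
    rw [Finset.mul_sum]
    refine Finset.sum_le_sum fun r hr => ?_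
    have hr0 : (0 : ℝ) < r := by exact_mod_cast (Finset.mem_Icc.1 hr).1
    calc (r : ℝ) * ⌊x ^ 2 / r ^ 2⌋₊ ≤ r * (x ^ 2 / r ^ 2) := by
          gcongr; exact Nat.floor_le (by positivity)
      _ = x ^ 2 * (r : ℝ)⁻¹ := by field_simp
  have hlo : x ^ 2 * ∑ r ∈ Finset.Icc 1 ⌊x⌋₊, (r : ℝ)⁻¹ - x ^ 2
      ≤ ∑ r ∈ Finset.Icc 1 ⌊x⌋₊, (r : ℝ) * ⌊x ^ 2 / r ^ 2⌋₊ := by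
    have h3 : ∑ r ∈ Finset.Icc 1 ⌊x⌋₊, x ≤ x ^ 2 := by
      rw [Finset.sum_const, Nat.card_Icc, nsmul_eq_mul, sq, Nat.add_sub_cancel]
      gcongr; exact Nat.floor_le hx0
    have h4 : x ^ 2 * ∑ r ∈ Finset.Icc 1 ⌊x⌋₊, (r : ℝ)⁻¹ - ∑ r ∈ Finset.Icc 1 ⌊x⌋₊, x
        ≤ ∑ r ∈ Finset.Icc 1 ⌊x⌋₊, (r : ℝ) * ⌊x ^ 2 / r ^ 2⌋₊ := by
      rw [Finset.mul_sum, ← Finset.sum_sub_distrib]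
      refine Finset.sum_le_sum fun r hr => ?_
      have hr0 : (0 : ℝ) < r := by exact_mod_cast (Finset.mem_Icc.1 hr).1
      have hrx : (r : ℝ) ≤ x := (Nat.le_floor_iff hx0).1 (Finset.mem_Icc.1 hr).2
      have h5 : x ^ 2 * (r : ℝ)⁻¹ = r * (x ^ 2 / r ^ 2) := by field_simp
      have h6 := (Nat.lt_floor_add_one (x ^ 2 / r ^ 2)).le
      rw [h5]
      nlinarith
    linarith
  rw [abs_le]
  constructor <;> nlinarith [sq_nonneg x]

/-- Compare with ∫ log u / u du = (log n)²/2. In the induction step the error is a difference of two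
terms lying in [0, 1/(n+1)]. -/
lemma sum_log_div (n : ℕ) :
    |∑ s ∈ Finset.Icc 1 n, Real.log s / s - Real.log n ^ 2 / 2|
      ≤ ∑ s ∈ Finset.Icc 1 n, (s : ℝ)⁻¹ := by
  induction n with
  | zero => simp
  | succ n ih =>
    rcases Nat.eq_zero_or_pos n with rfl | hn
    · simp
    rw [Finset.sum_Icc_succ_top (by omega), Finset.sum_Icc_succ_top (by omega)]
    have hn' : (1 : ℝ) ≤ n := by exact_mod_cast hn
    have hn0 : (0 : ℝ) < n := by linarith
    push_cast
    set l := Real.log n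
    set l' := Real.log ((n : ℝ) + 1)
    have hl0 : 0 ≤ l := Real.log_nonneg hn'
    have hl'n : l' ≤ n := by
      have := Real.log_le_sub_one_of_pos (by positivity : (0 : ℝ) < n + 1)
      linarith
    have hδ1 : l' - l ≤ 1 / n := by
      have h := Real.log_le_sub_one_of_pos (by positivity : (0 : ℝ) < (n + 1) / n)
      rw [Real.log_div (by positivity) hn0.ne'] at h
      calc l' - l ≤ _ := h
        _ = 1 / n := by field_simp; ring
    have hδ2 : 1 / ((n : ℝ) + 1) ≤ l' - l := by
      have h := Real.log_le_sub_one_of_pos (by positivity : (0 : ℝ) < n / (n + 1))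
      rw [Real.log_div hn0.ne' (by positivity)] at h
      have h2 : (n : ℝ) / (n + 1) - 1 = -(1 / (n + 1)) := by field_simp; ring
      rw [h2] at h
      linarith
    set δ := l' - l with hδ
    have hq : 0 < 1 / ((n : ℝ) + 1) := by positivity
    have hqn : 1 / (n : ℝ) - 1 / (n + 1) = 1 / n * (1 / (n + 1)) := by field_simp; ring
    have hnn : (n : ℝ) * (1 / n) = 1 := by field_simp
    have hqle : 1 / (n : ℝ) ≤ 2 * (1 / (n + 1)) := by
      rw [mul_one_div, div_le_div_iff₀ hn0 (by positivity)]; linarith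
    have hn1 : 1 / (n : ℝ) ≤ 1 := by rw [div_le_one hn0]; exact hn'
    have key : |l' / (n + 1) - (l' ^ 2 / 2 - l ^ 2 / 2)| ≤ ((n : ℝ) + 1)⁻¹ := by
      have e : l' / (n + 1) - (l' ^ 2 / 2 - l ^ 2 / 2)
          = -((δ - 1 / (n + 1)) * l') + δ ^ 2 / 2 := by rw [hδ]; ring
      have hl'0 : 0 ≤ l' := by linarith
      have b1 : (δ - 1 / ((n : ℝ) + 1)) * l' ≤ 1 / (n + 1) := by
        calc (δ - 1 / ((n : ℝ) + 1)) * l' ≤ (1 / n * (1 / (n + 1))) * n := by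
              rw [← hqn]; gcongr; rw [hqn]; positivity
          _ = 1 / (n + 1) := by field_simp
      have b2 : 0 ≤ (δ - 1 / ((n : ℝ) + 1)) * l' := mul_nonneg (by linarith) hl'0
      have b3 : δ ^ 2 / 2 ≤ 1 / (n + 1) := by nlinarith
      rw [e, ← one_div, abs_le]
      constructor <;> nlinarith [sq_nonneg δ]
    calc _ = |(∑ s ∈ Finset.Icc 1 n, Real.log s / s - l ^ 2 / 2)
          + (l' / (n + 1) - (l' ^ 2 / 2 - l ^ 2 / 2))| := by ring_nf
      _ ≤ _ := (abs_add_le _ _).trans (add_le_add ih key)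

/-- For fixed s this is `sum_mul_floor_sq` at x = √(B/s³), beyond which the weight vanishes. -/
lemma sum_weight_row {B : ℝ} {s : ℕ} (hs : 0 < s) (hsB : (s : ℝ) ^ 3 ≤ B) :
    |∑ r ∈ Finset.Icc 1 ⌊B⌋₊, weight B (r, s)
      - B * (s : ℝ)⁻¹ * ((Real.log B - 3 * Real.log s) / 2)| ≤ B * (s : ℝ)⁻¹ := by
  have hs0 : (0 : ℝ) < s := by exact_mod_cast hs
  have hs1 : (1 : ℝ) ≤ s := by exact_mod_cast hs
  have hB1 : 1 ≤ B := (one_le_pow₀ hs1).trans hsB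
  have hB0 : 0 < B := by linarith
  set x := Real.sqrt (B / s ^ 3) with hx
  have hx2 : x ^ 2 = B / s ^ 3 := Real.sq_sqrt (by positivity)
  have hx1 : 1 ≤ x := by
    rw [hx, Real.one_le_sqrt, one_le_div (by positivity)]; exact hsB
  have hlog : Real.log x = (Real.log B - 3 * Real.log s) / 2 := by
    rw [hx, Real.log_sqrt (by positivity), Real.log_div hB0.ne' (by positivity), Real.log_pow]
    norm_num
  have hxB : x ≤ B := by
    have h1 : B / (s : ℝ) ^ 3 ≤ B := div_le_self hB0.le (one_le_pow₀ hs1)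
    nlinarith
  have hrow : ∑ r ∈ Finset.Icc 1 ⌊B⌋₊, weight B (r, s)
      = s ^ 2 * ∑ r ∈ Finset.Icc 1 ⌊x⌋₊, (r : ℝ) * ⌊x ^ 2 / r ^ 2⌋₊ := by
    rw [Finset.mul_sum]
    symm
    have hterm : ∀ r : ℕ, weight B (r, s) = (s : ℝ) ^ 2 * (r * ⌊x ^ 2 / r ^ 2⌋₊) := fun r => by
      rw [weight, hx2, div_div, mul_comm ((s : ℝ) ^ 3)]; ring
    simp_rw [← hterm]
    refine Finset.sum_subset (Finset.Icc_subset_Icc_right (Nat.floor_le_floor hxB))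
      fun r hr hr' => ?_
    by_contra hne
    obtain ⟨h1, -, h3⟩ := of_weight_ne_zero hne
    simp only at h1 h3
    refine hr' (Finset.mem_Icc.2 ⟨h1, Nat.le_floor ?_⟩)
    have h4 : (r : ℝ) ^ 2 ≤ x ^ 2 := by
      rw [hx2, le_div_iff₀ (by positivity)]; exact h3
    exact le_of_sq_le_sq h4 (by linarith)
  have hsx : (s : ℝ) ^ 2 * x ^ 2 = B * (s : ℝ)⁻¹ := by rw [hx2]; field_simp
  rw [hrow, ← hlog, ← hsx]
  have h := sum_mul_floor_sq hx1
  rw [mul_assoc, ← mul_sub, abs_mul, abs_of_nonneg (by positivity : (0 : ℝ) ≤ (s : ℝ) ^ 2)]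
  gcongr

/-- With L = log B, summing the rows over s ≤ B^(1/3) gives B(Lh/2 - 3q/2), where h ≈ L/3 and q ≈
L²/18; hence BL²/12. -/
lemma weightedSum_one {B : ℝ} (hB : 1 ≤ B) :
    |weightedSum (fun _ => 1) B - B * (Real.log B ^ 2 / 12)| ≤ 10 * B * (1 + Real.log B) := by
  have hB0 : 0 < B := by linarith
  set L := Real.log B with hL
  have hL0 : 0 ≤ L := Real.log_nonneg hB
  set y := B ^ (1 / 3 : ℝ) with hy
  have hy1 : 1 ≤ y := Real.one_le_rpow hB (by norm_num)
  have hy3 : y ^ 3 = B := by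
    rw [hy, ← Real.rpow_natCast, ← Real.rpow_mul hB0.le]; norm_num
  have hylog : Real.log y = L / 3 := by rw [hy, Real.log_rpow hB0]; ring
  set Y := ⌊y⌋₊ with hY
  have hY1 : 1 ≤ Y := Nat.le_floor (by simpa using hy1)
  have hYy : (Y : ℝ) ≤ y := Nat.floor_le (by linarith)
  have hyB : y ≤ B := hy3 ▸ le_self_pow₀ hy1 (by norm_num)
  set h := ∑ s ∈ Finset.Icc 1 Y, (s : ℝ)⁻¹ with hh
  set q := ∑ s ∈ Finset.Icc 1 Y, Real.log s / s with hq
  set l := Real.log Y with hl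
  have hl0 : 0 ≤ l := Real.log_nonneg (by exact_mod_cast hY1)
  have hlu : l ≤ L / 3 := by
    rw [← hylog]; exact Real.log_le_log (by exact_mod_cast hY1) hYy
  -- Taking the floor of y ≥ 1 loses at most a factor 2, and log 2 < 1.
  have hll : L / 3 - 1 ≤ l := by
    have h1 : y ≤ 2 * Y := by
      have h2 := (Nat.lt_floor_add_one y).le
      have h3 : (1 : ℝ) ≤ Y := by exact_mod_cast hY1
      rw [← hY] at h2
      linarith
    have h2 := Real.log_le_log (by linarith) h1
    have hY0 : (Y : ℝ) ≠ 0 := by exact_mod_cast (by omega : Y ≠ 0)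
    rw [Real.log_mul (by norm_num) hY0, hylog] at h2
    linarith [Real.log_two_lt_d9]
  obtain ⟨hh1, hh2⟩ := sum_inv_Icc_mem hy1
  rw [← hh, hylog] at hh1 hh2
  have hqb := abs_le.1 (sum_log_div Y)
  rw [← hq, ← hl, ← hh] at hqb
  have hsum : weightedSum (fun _ => 1) B
      = ∑ s ∈ Finset.Icc 1 Y, ∑ r ∈ Finset.Icc 1 ⌊B⌋₊, weight B (r, s) := by
    rw [weightedSum_eq_sum, Finset.sum_product_right]
    simp only [one_mul]
    symm
    refine Finset.sum_subset (Finset.Icc_subset_Icc_right (Nat.floor_le_floor hyB))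
      fun s hs hs' => Finset.sum_eq_zero fun r hr => ?_
    by_contra hne
    obtain ⟨h1, h2, h3⟩ := of_weight_ne_zero hne
    simp only at h1 h2 h3
    refine hs' (Finset.mem_Icc.2 ⟨h2, Nat.le_floor ?_⟩)
    have h4 : (1 : ℝ) ≤ (r : ℝ) ^ 2 := one_le_pow₀ (by exact_mod_cast h1)
    have h5 : (s : ℝ) ^ 3 ≤ y ^ 3 := by
      rw [hy3]
      refine le_trans ?_ h3
      exact le_mul_of_one_le_left (by positivity) h4
    exact le_of_pow_le_pow_left₀ (by norm_num) (by linarith) h5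
  have hmain : |weightedSum (fun _ => 1) B - B * (L * h / 2 - 3 * q / 2)| ≤ B * h := by
    have e : B * (L * h / 2 - 3 * q / 2)
        = ∑ s ∈ Finset.Icc 1 Y, B * (s : ℝ)⁻¹ * ((L - 3 * Real.log s) / 2) := by
      rw [hh, hq, Finset.mul_sum, Finset.mul_sum, Finset.sum_div, Finset.sum_div,
        ← Finset.sum_sub_distrib, Finset.mul_sum]
      refine Finset.sum_congr rfl fun s _ => ?_
      rw [div_eq_mul_inv (Real.log s)]; ring
    rw [hsum, e, ← Finset.sum_sub_distrib, hh, Finset.mul_sum]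
    refine (Finset.abs_sum_le_sum_abs _ _).trans (Finset.sum_le_sum fun s hs => ?_)
    obtain ⟨hs1, hs2⟩ := Finset.mem_Icc.1 hs
    refine sum_weight_row hs1 ?_
    rw [← hy3]
    gcongr
    exact (Nat.cast_le.2 hs2).trans hYy
  have hfin : |(L * h / 2 - 3 * q / 2) - L ^ 2 / 12| ≤ 8 * (1 + L) := by
    have l1 : l ^ 2 ≤ L ^ 2 / 9 := by nlinarith
    have l2 : L ^ 2 / 9 - 2 * L / 3 ≤ l ^ 2 := by nlinarith
    have m1 : L * h ≤ L * (1 + L / 3) := by gcongr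
    have m2 : L * (L / 3) ≤ L * h := by gcongr
    rw [abs_le]
    constructor <;> nlinarith
  calc |weightedSum (fun _ => 1) B - B * (L ^ 2 / 12)|
      = |(weightedSum (fun _ => 1) B - B * (L * h / 2 - 3 * q / 2))
          + B * ((L * h / 2 - 3 * q / 2) - L ^ 2 / 12)| := by ring_nf
    _ ≤ B * h + B * (8 * (1 + L)) := by
        refine (abs_add_le _ _).trans (add_le_add hmain ?_)
        rw [abs_mul, abs_of_pos hB0]
        gcongr
    _ ≤ 10 * B * (1 + L) := by nlinarith [mul_nonneg hB0.le hL0]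

lemma weightedSum_of_lt_one (F : ℕ × ℕ → ℝ) {B : ℝ} (hB : B < 1) : weightedSum F B = 0 := by
  rw [weightedSum_eq_sum, Nat.floor_eq_zero.2 hB]; simp

/-- A bound valid for every k ≥ 1, even k > B where the sum is empty, so that it can be summed over
primes. -/
lemma weightedSum_one_div_le {B k : ℝ} (hB : 1 ≤ B) (hk : 1 ≤ k) :
    weightedSum (fun _ => 1) (B / k) ≤ 11 * (B / k) * (1 + Real.log B) ^ 2 := by
  have hk0 : 0 < k := by linarith
  have hBk : 0 < B / k := by positivity
  rcases lt_or_ge (B / k) 1 with h | h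
  · rw [weightedSum_of_lt_one _ h]; positivity
  · have h1 := (abs_le.1 (weightedSum_one h)).2
    have h2 : Real.log (B / k) ≤ Real.log B :=
      Real.log_le_log hBk (div_le_self (by linarith) hk)
    have h3 : 0 ≤ Real.log (B / k) := Real.log_nonneg h
    set l := Real.log (B / k)
    have h4 : weightedSum (fun _ => 1) (B / k) ≤ 11 * (B / k) * (1 + l) ^ 2 := by
      nlinarith [mul_nonneg hBk.le h3, mul_nonneg hBk.le (sq_nonneg l)]
    refine h4.trans ?_
    gcongr

open Filter Topology

/-! ### Densities -/

/-- The sum of `F` weighted by `weight B` is asymptotic to `c B (log B)^2`. -/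
def HasDensity (F : ℕ × ℕ → ℝ) (c : ℝ) : Prop :=
  Tendsto (fun B : ℝ => weightedSum F B / (B * Real.log B ^ 2)) atTop (𝓝 c)

lemma HasDensity.add {F G : ℕ × ℕ → ℝ} {c d : ℝ} (hF : HasDensity F c) (hG : HasDensity G d) :
    HasDensity (fun x => F x + G x) (c + d) := by
  refine (Tendsto.add hF hG).congr fun B => ?_
  rw [← add_div]
  congr 1
  unfold weightedSum
  rw [← (summable_mul_weight F B).tsum_add (summable_mul_weight G B)]
  simp only [add_mul]

lemma HasDensity.const_mul {F : ℕ × ℕ → ℝ} {c : ℝ} (a : ℝ) (hF : HasDensity F c) :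
    HasDensity (fun x => a * F x) (a * c) := by
  refine (Tendsto.const_mul a hF).congr fun B => ?_
  rw [← mul_div_assoc]
  congr 1
  unfold weightedSum
  rw [← tsum_mul_left]
  simp only [mul_assoc]

lemma hasDensity_one : HasDensity (fun _ => 1) (1 / 12) := by
  have h0 : Tendsto (fun B : ℝ => 10 * ((Real.log B)⁻¹ ^ 2 + (Real.log B)⁻¹)) atTop (𝓝 0) := by
    have h := tendsto_inv_atTop_zero.comp Real.tendsto_log_atTop
    have h2 := ((h.pow 2).add h).const_mul 10
    simpa using h2
  refine tendsto_of_tendsto_of_dist (f₁ := fun _ => (1 / 12 : ℝ)) tendsto_const_nhds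
    (squeeze_zero' (Eventually.of_forall fun _ => dist_nonneg) ?_ h0)
  filter_upwards [eventually_gt_atTop 1] with B hB
  have hB0 : 0 < B := by linarith
  have hL : 0 < Real.log B := Real.log_pos hB
  have hW := weightedSum_one hB.le
  rw [dist_comm, Real.dist_eq]
  set L := Real.log B
  set W := weightedSum (fun _ => 1) B
  have e : W / (B * L ^ 2) - 1 / 12 = (W - B * (L ^ 2 / 12)) / (B * L ^ 2) := by field_simp
  rw [e, abs_div, abs_of_pos (by positivity : 0 < B * L ^ 2), div_le_iff₀ (by positivity)]
  refine hW.trans (le_of_eq ?_)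
  field_simp

/-- log(B/k) ∼ log B, so rescaling B only contributes the factor 1/k. -/
lemma tendsto_comp_div {u : ℝ → ℝ} {c k : ℝ} (hk : 0 < k)
    (hu : Tendsto (fun B : ℝ => u B / (B * Real.log B ^ 2)) atTop (𝓝 c)) :
    Tendsto (fun B : ℝ => u (B / k) / (B * Real.log B ^ 2)) atTop (𝓝 (c / k)) := by
  have h1 := hu.comp (tendsto_id.atTop_div_const hk)
  have h2 : Tendsto (fun B : ℝ => (1 - Real.log k / Real.log B) ^ 2) atTop (𝓝 1) := by
    have h := (tendsto_const_nhds (x := Real.log k)).div_atTop Real.tendsto_log_atTop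
    simpa using (tendsto_const_nhds (x := (1 : ℝ)).sub h).pow 2
  have h3 := (h1.mul h2).div_const k
  rw [mul_one] at h3
  refine h3.congr' ?_
  filter_upwards [eventually_gt_atTop 1, eventually_gt_atTop k] with B hB hBk
  have hB0 : 0 < B := by linarith
  have hL : 0 < Real.log B := Real.log_pos hB
  have hL' : 0 < Real.log B - Real.log k := sub_pos.2 (Real.log_lt_log hk hBk)
  simp only [Function.comp, id]
  rw [Real.log_div hB0.ne' hk.ne']
  field_simp

/-- Put r = kr': the factor r of the weight yields k, and r² in the floor turns B into B/k². The
resulting density is k · k⁻² = 1/k; for s it is k² · k⁻³ = 1/k. -/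
lemma weightedSum_dvd_fst (F : ℕ × ℕ → ℝ) (B : ℝ) {k : ℕ} (hk : 0 < k) :
    weightedSum (fun x => if k ∣ x.1 then F x else 0) B
      = k * weightedSum (fun x => F (k * x.1, x.2)) (B / (k : ℝ) ^ 2) := by
  have hk0 : (k : ℝ) ≠ 0 := by exact_mod_cast hk.ne'
  have hinj : Function.Injective fun x : ℕ × ℕ => (k * x.1, x.2) := by
    rintro ⟨r, s⟩ ⟨r', s'⟩ h
    simp only [Prod.mk.injEq, mul_eq_mul_left_iff, hk.ne', or_false] at h
    exact Prod.ext h.1 h.2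
  unfold weightedSum
  rw [← tsum_mul_left, ← hinj.tsum_eq]
  · refine tsum_congr fun x => ?_
    simp only [dvd_mul_right, if_true, weight]
    have : B / (((k * x.1 : ℕ) : ℝ) ^ 2 * (x.2 : ℝ) ^ 3)
        = B / (k : ℝ) ^ 2 / ((x.1 : ℝ) ^ 2 * (x.2 : ℝ) ^ 3) := by
      rw [div_div]; push_cast; ring_nf
    rw [this]
    push_cast; ring
  · intro x hx
    by_cases h : k ∣ x.1
    · obtain ⟨r, hr⟩ := h
      exact ⟨(r, x.2), Prod.ext hr.symm rfl⟩
    · simp [h] at hx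

lemma weightedSum_dvd_snd (F : ℕ × ℕ → ℝ) (B : ℝ) {k : ℕ} (hk : 0 < k) :
    weightedSum (fun x => if k ∣ x.2 then F x else 0) B
      = k ^ 2 * weightedSum (fun x => F (x.1, k * x.2)) (B / (k : ℝ) ^ 3) := by
  have hk0 : (k : ℝ) ≠ 0 := by exact_mod_cast hk.ne'
  have hinj : Function.Injective fun x : ℕ × ℕ => (x.1, k * x.2) := by
    rintro ⟨r, s⟩ ⟨r', s'⟩ h
    simp only [Prod.mk.injEq, mul_eq_mul_left_iff, hk.ne', or_false] at h
    exact Prod.ext h.1 h.2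
  unfold weightedSum
  rw [← tsum_mul_left, ← hinj.tsum_eq]
  · refine tsum_congr fun x => ?_
    simp only [dvd_mul_right, if_true, weight]
    have : B / ((x.1 : ℝ) ^ 2 * ((k * x.2 : ℕ) : ℝ) ^ 3)
        = B / (k : ℝ) ^ 3 / ((x.1 : ℝ) ^ 2 * (x.2 : ℝ) ^ 3) := by
      rw [div_div]; push_cast; ring_nf
    rw [this]
    push_cast; ring
  · intro x hx
    by_cases h : k ∣ x.2
    · obtain ⟨r, hr⟩ := h
      exact ⟨(x.1, r), Prod.ext rfl hr.symm⟩
    · simp [h] at hx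

lemma HasDensity.dvd_fst {F : ℕ × ℕ → ℝ} {c : ℝ} {k : ℕ} (hk : 0 < k)
    (hF : HasDensity F c) (hinv : ∀ r s, F (k * r, s) = F (r, s)) :
    HasDensity (fun x => if k ∣ x.1 then F x else 0) (c / k) := by
  have hk0 : (0 : ℝ) < k := by exact_mod_cast hk
  have h := (tendsto_comp_div (by positivity : (0 : ℝ) < (k : ℝ) ^ 2) hF).const_mul (k : ℝ)
  have e : (k : ℝ) * (c / (k : ℝ) ^ 2) = c / k := by field_simp
  rw [e] at h
  refine h.congr fun B => ?_
  rw [weightedSum_dvd_fst F B hk, mul_div_assoc]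
  simp only [hinv]

lemma HasDensity.dvd_snd {F : ℕ × ℕ → ℝ} {c : ℝ} {k : ℕ} (hk : 0 < k)
    (hF : HasDensity F c) (hinv : ∀ r s, F (r, k * s) = F (r, s)) :
    HasDensity (fun x => if k ∣ x.2 then F x else 0) (c / k) := by
  have hk0 : (0 : ℝ) < k := by exact_mod_cast hk
  have h := (tendsto_comp_div (by positivity : (0 : ℝ) < (k : ℝ) ^ 3) hF).const_mul ((k : ℝ) ^ 2)
  have e : (k : ℝ) ^ 2 * (c / (k : ℝ) ^ 3) = c / k := by field_simp
  rw [e] at h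
  refine h.congr fun B => ?_
  rw [weightedSum_dvd_snd F B hk, mul_div_assoc]
  simp only [hinv]

/-! ### Local factors -/

/-- The factor at `p` of the function `(r, s) ↦ μ(r)^2 ∏_{p ∣ r s} (1 - A p)`. -/
noncomputable def localFactor (A : ℕ → ℝ) (p : ℕ) (x : ℕ × ℕ) : ℝ :=
  if p ^ 2 ∣ x.1 then 0 else if p ∣ x.1 ∨ p ∣ x.2 then 1 - A p else 1

/-- The mean value of `localFactor A p`. -/
noncomputable def localMean (A : ℕ → ℝ) (p : ℕ) : ℝ :=
  1 - 2 * A p * (p : ℝ)⁻¹ + A p * (p : ℝ)⁻¹ ^ 2 - (1 - A p) * (p : ℝ)⁻¹ ^ 2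

lemma localFactor_mul_fst (A : ℕ → ℝ) {p q : ℕ} (hp : p.Prime) (hq : q.Prime) (hpq : p ≠ q)
    (r s : ℕ) : localFactor A q (p * r, s) = localFactor A q (r, s) := by
  have hc : Nat.Coprime q p := (Nat.coprime_primes hq hp).2 hpq.symm
  have h1 : q ^ 2 ∣ p * r ↔ q ^ 2 ∣ r := (hc.pow_left 2).dvd_mul_left
  have h2 : q ∣ p * r ↔ q ∣ r := hc.dvd_mul_left
  simp only [localFactor, h1, h2]

lemma localFactor_mul_snd (A : ℕ → ℝ) {p q : ℕ} (hp : p.Prime) (hq : q.Prime) (hpq : p ≠ q)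
    (r s : ℕ) : localFactor A q (r, p * s) = localFactor A q (r, s) := by
  have hc : Nat.Coprime q p := (Nat.coprime_primes hq hp).2 hpq.symm
  have h2 : q ∣ p * s ↔ q ∣ s := hc.dvd_mul_left
  simp only [localFactor, h2]

/-- The factor at p equals 1 - A·[p∣r] - A·[p∣s] + A·[p∣r][p∣s] - (1-A)·[p²∣r]. The other factors do
not change when r or s is multiplied by p, so each indicator just multiplies the density by 1/p or
1/p². -/
lemma hasDensity_prod_localFactor (A : ℕ → ℝ) (t : Finset Nat.Primes) :
    HasDensity (fun x => ∏ p ∈ t, localFactor A p x) (1 / 12 * ∏ p ∈ t, localMean A p) := by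
  induction t using Finset.induction_on with
  | empty => simpa using hasDensity_one
  | insert p t hp ih =>
    set F : ℕ × ℕ → ℝ := fun x => ∏ p ∈ t, localFactor A p x
    set c : ℝ := 1 / 12 * ∏ p ∈ t, localMean A p
    have hne : ∀ q ∈ t, (p : ℕ) ≠ q := fun q hq h => hp (by rwa [Subtype.ext h])
    have inv1 : ∀ r s, F (p * r, s) = F (r, s) := fun r s =>
      Finset.prod_congr rfl fun q hq => localFactor_mul_fst A p.2 q.2 (hne q hq) r s
    have inv2 : ∀ r s, F (r, p * s) = F (r, s) := fun r s =>
      Finset.prod_congr rfl fun q hq => localFactor_mul_snd A p.2 q.2 (hne q hq) r s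
    have inv3 : ∀ r s, F ((p : ℕ) ^ 2 * r, s) = F (r, s) := fun r s => by
      rw [sq, mul_assoc, inv1, inv1]
    have d1 := HasDensity.dvd_fst p.2.pos ih inv1
    have d2 := HasDensity.dvd_snd p.2.pos ih inv2
    have d3 := HasDensity.dvd_fst (pow_pos p.2.pos 2) ih inv3
    have d12 := HasDensity.dvd_fst p.2.pos d2 fun r s => by simp only [inv1]
    have h := (((ih.add (d1.const_mul (-A p))).add (d2.const_mul (-A p))).add
      (d12.const_mul (A p))).add (d3.const_mul (-(1 - A p)))
    have hp0 : ((p : ℕ) : ℝ) ≠ 0 := by exact_mod_cast p.2.ne_zero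
    convert h using 1
    · funext x
      rw [Finset.prod_insert hp]
      change localFactor A p x * F x = _
      have hdvd : (p : ℕ) ^ 2 ∣ x.1 → (p : ℕ) ∣ x.1 := (dvd_pow_self _ two_ne_zero).trans
      unfold localFactor
      by_cases h1 : (p : ℕ) ∣ x.1 <;> by_cases h2 : (p : ℕ) ∣ x.2 <;>
        by_cases h3 : (p : ℕ) ^ 2 ∣ x.1 <;> simp [h1, h2, h3] <;>
        first | exact absurd (hdvd h3) h1 | ring
    · rw [Finset.prod_insert hp, localMean]
      push_cast
      simp only [c]
      field_simp
      ring

lemma localFactor_mem {A : ℕ → ℝ} {p : Nat.Primes} (hA : 0 ≤ A p ∧ A p ≤ ((p : ℕ) : ℝ)⁻¹)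
    (x : ℕ × ℕ) : 0 ≤ localFactor A p x ∧ localFactor A p x ≤ 1 := by
  obtain ⟨h0, h1⟩ := hA
  have h2 : ((p : ℕ) : ℝ)⁻¹ ≤ 1 := inv_le_one_of_one_le₀ (by exact_mod_cast p.2.one_le)
  unfold localFactor
  split_ifs <;> constructor <;> linarith

/-- Bound 1 - `localFactor` by A·[p∣r] + A·[p∣s] + [p²∣r]. As A ≤ 1/p, each of the three terms
contributes at most 11p⁻²B(1 + log B)². -/
lemma weightedSum_one_sub_localFactor_le {A : ℕ → ℝ} {p : Nat.Primes}
    (hA : 0 ≤ A p ∧ A p ≤ ((p : ℕ) : ℝ)⁻¹) {B : ℝ} (hB : 1 ≤ B) :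
    weightedSum (fun x => 1 - localFactor A p x) B
      ≤ ((p : ℕ) : ℝ)⁻¹ ^ 2 * (33 * B * (1 + Real.log B) ^ 2) := by
  obtain ⟨h0, h1⟩ := hA
  have hp1 : (1 : ℝ) ≤ (p : ℕ) := by exact_mod_cast p.2.one_le
  have hp0 : (0 : ℝ) < (p : ℕ) := by linarith
  have hle : weightedSum (fun x => 1 - localFactor A p x) B
      ≤ A p * weightedSum (fun x => if (p : ℕ) ∣ x.1 then 1 else 0) B
        + A p * weightedSum (fun x => if (p : ℕ) ∣ x.2 then 1 else 0) B
        + weightedSum (fun x => if (p : ℕ) ^ 2 ∣ x.1 then 1 else 0) B := by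
    unfold weightedSum
    rw [← tsum_mul_left, ← tsum_mul_left,
      ← ((summable_mul_weight _ B).mul_left _).tsum_add ((summable_mul_weight _ B).mul_left _),
      ← (((summable_mul_weight _ B).mul_left _).add
        ((summable_mul_weight _ B).mul_left _)).tsum_add (summable_mul_weight _ B)]
    refine (summable_mul_weight _ B).tsum_le_tsum (fun x => ?_)
      ((((summable_mul_weight _ B).mul_left _).add
        ((summable_mul_weight _ B).mul_left _)).add (summable_mul_weight _ B))
    rw [← mul_assoc, ← mul_assoc, ← add_mul, ← add_mul]
    refine mul_le_mul_of_nonneg_right ?_ (weight_nonneg B x)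
    unfold localFactor
    by_cases h1 : (p : ℕ) ∣ x.1 <;> by_cases h2 : (p : ℕ) ∣ x.2 <;>
      by_cases h3 : (p : ℕ) ^ 2 ∣ x.1 <;> simp [h1, h2, h3] <;> linarith
  rw [weightedSum_dvd_fst _ B p.2.pos, weightedSum_dvd_snd _ B p.2.pos,
    weightedSum_dvd_fst _ B (pow_pos p.2.pos 2)] at hle
  have b1 := weightedSum_one_div_le hB (one_le_pow₀ hp1 : 1 ≤ ((p : ℕ) : ℝ) ^ 2)
  have b2 := weightedSum_one_div_le hB (one_le_pow₀ hp1 : 1 ≤ ((p : ℕ) : ℝ) ^ 3)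
  have b3 := weightedSum_one_div_le hB
    (one_le_pow₀ (one_le_pow₀ hp1) : 1 ≤ (((p : ℕ) : ℝ) ^ 2) ^ 2)
  push_cast at hle
  set X := (1 + Real.log B) ^ 2
  have hX : 0 ≤ X := sq_nonneg _
  set q := ((p : ℕ) : ℝ) with hq
  refine hle.trans ?_
  calc _ ≤ q⁻¹ * (q * (11 * (B / q ^ 2) * X)) + q⁻¹ * (q ^ 2 * (11 * (B / q ^ 3) * X))
        + q ^ 2 * (11 * (B / (q ^ 2) ^ 2) * X) := by
        have c1 := mul_le_mul_of_nonneg_left b1 hp0.le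
        have c2 := mul_le_mul_of_nonneg_left b2 (sq_nonneg q)
        have c3 := mul_le_mul_of_nonneg_left b3 (sq_nonneg q)
        have hB0 : 0 ≤ B := by linarith
        refine add_le_add (add_le_add ?_ ?_) c3
        · exact (mul_le_mul_of_nonneg_left c1 h0).trans
            (mul_le_mul_of_nonneg_right h1 (by positivity))
        · exact (mul_le_mul_of_nonneg_left c2 h0).trans
            (mul_le_mul_of_nonneg_right h1 (by positivity))
    _ = q⁻¹ ^ 2 * (33 * B * X) := by field_simp; ring

lemma one_sub_prod_le_sum {ι : Type*} (t : Finset ι) {f : ι → ℝ}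
    (hf : ∀ i ∈ t, 0 ≤ f i ∧ f i ≤ 1) : 1 - ∏ i ∈ t, f i ≤ ∑ i ∈ t, (1 - f i) := by
  classical
  induction t using Finset.induction_on with
  | empty => simp
  | insert i t hi ih =>
    have ih := ih fun j hj => hf j (Finset.mem_insert_of_mem hj)
    obtain ⟨h0, h1⟩ := hf i (Finset.mem_insert_self i t)
    have h2 : ∏ j ∈ t, f j ≤ 1 := Finset.prod_le_one
      (fun j hj => (hf j (Finset.mem_insert_of_mem hj)).1)
      fun j hj => (hf j (Finset.mem_insert_of_mem hj)).2
    rw [Finset.prod_insert hi, Finset.sum_insert hi]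
    nlinarith

/-- The function `(r, s) ↦ μ(r)^2 ∏_{p ∣ r s} (1 - A p)`. -/
noncomputable def sieveWeight (A : ℕ → ℝ) (x : ℕ × ℕ) : ℝ :=
  if Squarefree x.1 then ∏ p ∈ (x.1 * x.2).primeFactors, (1 - A p) else 0

lemma sieveWeight_eq_prod (A : ℕ → ℝ) {x : ℕ × ℕ} (h1 : 0 < x.1) (h2 : 0 < x.2)
    {t : Finset Nat.Primes} (ht : ∀ p : Nat.Primes, (p : ℕ) ≤ x.1 ∨ (p : ℕ) ≤ x.2 → p ∈ t) :
    sieveWeight A x = ∏ p ∈ t, localFactor A p x := by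
  unfold sieveWeight
  split_ifs with hsq
  · have e : ∀ p ∈ t, localFactor A p x = if (p : ℕ) ∣ x.1 * x.2 then 1 - A p else 1 := by
      intro p _
      have h : ¬ (p : ℕ) ^ 2 ∣ x.1 := fun h =>
        Nat.squarefree_iff_prime_squarefree.1 hsq p p.2 (sq (p : ℕ) ▸ h)
      simp only [localFactor, h, if_false, p.2.dvd_mul]
    rw [Finset.prod_congr rfl e, ← Finset.prod_filter]
    symm
    refine Finset.prod_nbij (fun p : Nat.Primes => (p : ℕ)) ?_ ?_ ?_ fun _ _ => rfl
    · intro p hp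
      exact Nat.mem_primeFactors.2 ⟨p.2, (Finset.mem_filter.1 hp).2, by positivity⟩
    · exact fun p _ q _ h => Subtype.ext h
    · intro p hp
      obtain ⟨hpp, hd, -⟩ := Nat.mem_primeFactors.1 hp
      refine ⟨⟨p, hpp⟩, ?_, rfl⟩
      refine Finset.mem_coe.2 (Finset.mem_filter.2 ⟨ht _ ?_, hd⟩)
      exact (hpp.dvd_mul.1 hd).imp (Nat.le_of_dvd h1) (Nat.le_of_dvd h2)
  · rw [Nat.squarefree_iff_prime_squarefree] at hsq
    push Not at hsq
    obtain ⟨p, hp, hd⟩ := hsq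
    symm
    refine Finset.prod_eq_zero (i := (⟨p, hp⟩ : Nat.Primes))
      (ht _ (Or.inl (Nat.le_of_dvd h1 ((dvd_mul_right p p).trans hd)))) ?_
    rw [← sq] at hd
    exact if_pos hd

/-- On the support of the weight r, s ≤ B, so only primes up to B matter. Those outside t are
removed by the union bound `one_sub_prod_le_sum`, with an error uniform in B. -/
lemma weightedSum_prod_sub_sieveWeight {A : ℕ → ℝ}
    (hA : ∀ p : Nat.Primes, 0 ≤ A p ∧ A p ≤ ((p : ℕ) : ℝ)⁻¹) {t : Finset Nat.Primes} {ε : ℝ}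
    (ht : ∀ u : Finset Nat.Primes, Disjoint u t → ∑ p ∈ u, ((p : ℕ) : ℝ)⁻¹ ^ 2 ≤ ε)
    {B : ℝ} (hB : 1 ≤ B) :
    |weightedSum (sieveWeight A) B - weightedSum (fun x => ∏ p ∈ t, localFactor A p x) B|
      ≤ ε * (33 * B * (1 + Real.log B) ^ 2) := by
  classical
  obtain ⟨P, hP⟩ : ∃ P : Finset Nat.Primes, ∀ p : Nat.Primes, (p : ℕ) ≤ ⌊B⌋₊ → p ∈ P :=
    ⟨Finset.subtype Nat.Prime (Finset.range (⌊B⌋₊ + 1)), fun p hp =>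
      Finset.mem_subtype.2 (Finset.mem_range.2 (by omega))⟩
  set u : Finset Nat.Primes := P \ t
  have hf := fun (x : ℕ × ℕ) (p : Nat.Primes) => localFactor_mem (hA p) x
  have key : ∀ x, 0 < x.1 → 0 < x.2 → x.1 ≤ ⌊B⌋₊ → x.2 ≤ ⌊B⌋₊ →
      sieveWeight A x = (∏ p ∈ t, localFactor A p x) * ∏ p ∈ u, localFactor A p x := by
    intro x h1 h2 h3 h4
    rw [← Finset.prod_union (Finset.disjoint_sdiff : Disjoint t u)]
    refine sieveWeight_eq_prod A h1 h2 fun p hp => ?_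
    rw [Finset.union_sdiff_self_eq_union, Finset.mem_union]
    exact Or.inr (hP p (by omega))
  have hbd : ∀ x ∈ Finset.Icc 1 ⌊B⌋₊ ×ˢ Finset.Icc 1 ⌊B⌋₊,
      |sieveWeight A x * weight B x - (∏ p ∈ t, localFactor A p x) * weight B x|
        ≤ ∑ p ∈ u, (1 - localFactor A p x) * weight B x := by
    intro x hx
    rw [Finset.mem_product, Finset.mem_Icc, Finset.mem_Icc] at hx
    rw [key x hx.1.1 hx.2.1 hx.1.2 hx.2.2, ← sub_mul, abs_mul, abs_of_nonneg (weight_nonneg B x),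
      ← Finset.sum_mul]
    refine mul_le_mul_of_nonneg_right ?_ (weight_nonneg B x)
    have h1 := one_sub_prod_le_sum u fun p _ => hf x p
    have h2 : 0 ≤ ∏ p ∈ t, localFactor A p x := Finset.prod_nonneg fun p _ => (hf x p).1
    have h3 : ∏ p ∈ t, localFactor A p x ≤ 1 :=
      Finset.prod_le_one (fun p _ => (hf x p).1) fun p _ => (hf x p).2
    have h4 : ∏ p ∈ u, localFactor A p x ≤ 1 :=
      Finset.prod_le_one (fun p _ => (hf x p).1) fun p _ => (hf x p).2
    rw [abs_sub_comm, abs_le]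
    constructor <;> nlinarith
  calc |weightedSum (sieveWeight A) B - weightedSum (fun x => ∏ p ∈ t, localFactor A p x) B|
      ≤ ∑ x ∈ Finset.Icc 1 ⌊B⌋₊ ×ˢ Finset.Icc 1 ⌊B⌋₊,
          ∑ p ∈ u, (1 - localFactor A p x) * weight B x := by
        rw [weightedSum_eq_sum, weightedSum_eq_sum, ← Finset.sum_sub_distrib]
        exact (Finset.abs_sum_le_sum_abs _ _).trans (Finset.sum_le_sum hbd)
    _ = ∑ p ∈ u, weightedSum (fun x => 1 - localFactor A p x) B := by
        rw [Finset.sum_comm]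
        exact Finset.sum_congr rfl fun p _ => (weightedSum_eq_sum _ B).symm
    _ ≤ ∑ p ∈ u, ((p : ℕ) : ℝ)⁻¹ ^ 2 * (33 * B * (1 + Real.log B) ^ 2) :=
        Finset.sum_le_sum fun p _ => weightedSum_one_sub_localFactor_le (hA p) hB
    _ ≤ _ := by
        rw [← Finset.sum_mul]
        exact mul_le_mul_of_nonneg_right (ht u Finset.sdiff_disjoint) (by positivity)

lemma summable_primes_inv_sq : Summable fun p : Nat.Primes => ((p : ℕ) : ℝ)⁻¹ ^ 2 := by
  have h := (Real.summable_nat_pow_inv (p := 2)).2 (by norm_num)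
  exact (h.comp_injective Nat.Primes.coe_nat_injective).congr fun p => by simp

theorem hasDensity_sieveWeight {A : ℕ → ℝ}
    (hA : ∀ p : Nat.Primes, 0 ≤ A p ∧ A p ≤ ((p : ℕ) : ℝ)⁻¹) {E : ℝ}
    (hE : HasProd (fun p : Nat.Primes => localMean A p) E) :
    HasDensity (sieveWeight A) (1 / 12 * E) := by
  classical
  rw [HasDensity, Metric.tendsto_nhds]
  intro ε hε
  -- Since 1 + L ≤ 2L once B ≥ e, the tail costs 33 · 4η = 132η; the two limits cost η each, and 134
  -- < 200.
  set η := ε / 200 with hη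
  have hη0 : 0 < η := by positivity
  obtain ⟨t₀, ht₀⟩ := summable_iff_vanishing_norm.1 summable_primes_inv_sq η hη0
  obtain ⟨t₁, ht₁⟩ := Filter.eventually_atTop.1
    (Metric.tendsto_nhds.1 (hE.const_mul (1 / 12 : ℝ)) η hη0)
  set t := t₀ ∪ t₁
  have hc := ht₁ t Finset.subset_union_right
  have htail : ∀ u : Finset Nat.Primes, Disjoint u t → ∑ p ∈ u, ((p : ℕ) : ℝ)⁻¹ ^ 2 ≤ η :=
    fun u hu => (le_abs_self _).trans
      (ht₀ u (hu.mono_right Finset.subset_union_left)).le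
  have hd := Metric.tendsto_nhds.1 (hasDensity_prod_localFactor A t) η hη0
  filter_upwards [hd, eventually_ge_atTop (Real.exp 1)] with B hdB hB
  have hB1 : 1 ≤ B := (Real.one_le_exp zero_le_one).trans hB
  have hB0 : 0 < B := by linarith
  have hL : 1 ≤ Real.log B := by rwa [Real.le_log_iff_exp_le hB0]
  have hw := weightedSum_prod_sub_sieveWeight hA htail hB1
  rw [Real.dist_eq] at hdB hc ⊢
  set L := Real.log B
  set W := weightedSum (sieveWeight A) B
  set V := weightedSum (fun x => ∏ p ∈ t, localFactor A p x) B
  have hpos : 0 < B * L ^ 2 := by positivity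
  have h1 : |W / (B * L ^ 2) - V / (B * L ^ 2)| ≤ 132 * η := by
    rw [← sub_div, abs_div, abs_of_pos hpos, div_le_iff₀ hpos]
    refine hw.trans ?_
    have : (1 + L) ^ 2 ≤ 4 * L ^ 2 := by nlinarith
    calc η * (33 * B * (1 + L) ^ 2) ≤ η * (33 * B * (4 * L ^ 2)) := by gcongr
      _ = _ := by ring
  have h2 := abs_le.1 h1
  have h3 := abs_lt.1 hdB
  have h4 := abs_lt.1 hc
  rw [abs_lt]
  constructor <;> linarith

/-! ### From subrings to weighted sums -/

/-- From s² ∣ a² follows a = sk; then r ∣ k², and squarefreeness gives r ∣ k. -/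
lemma dvd_sq_iff_of_squarefree {r s a : ℕ} (hr : Squarefree r) (hs : 0 < s) :
    r * s ^ 2 ∣ a ^ 2 ↔ r * s ∣ a := by
  constructor
  · intro h
    obtain ⟨k, rfl⟩ : s ∣ a := (Nat.pow_dvd_pow_iff two_ne_zero).1 ((dvd_mul_left _ _).trans h)
    rw [mul_pow, mul_comm] at h
    have h1 : r ∣ k ^ 2 := Nat.dvd_of_mul_dvd_mul_left (pow_pos hs 2) h
    rw [mul_comm]
    exact Nat.mul_dvd_mul_left _ ((hr.dvd_pow_iff_dvd two_ne_zero).1 h1)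
  · rintro ⟨k, rfl⟩
    exact ⟨r * k ^ 2, by ring⟩

/-- The bijection is (r, s, m) ↦ (n, a, d) = (mr²s³, mrs, rs²), with r squarefree. -/
lemma sum_divisorsAntidiagonal_eq_weightedSum {v : ℕ → ℝ} {F : ℕ × ℕ → ℝ}
    (hF : ∀ r s, 0 < r → 0 < s → Squarefree r → F (r, s) * (r * s ^ 2) = v (r * s ^ 2))
    (hF0 : ∀ r s, ¬ Squarefree r → F (r, s) = 0) (B : ℝ) :
    ∑ n ∈ Finset.Icc 1 ⌊B⌋₊, ∑ x ∈ n.divisorsAntidiagonal with x.2 ∣ x.1 ^ 2, v x.2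
      = weightedSum F B := by
  classical
  set M := ⌊B⌋₊ with hM
  have hrhs : weightedSum F B = ∑ x ∈ (Finset.Icc 1 M ×ˢ Finset.Icc 1 M).filter
      (fun x => Squarefree x.1), ∑ m ∈ Finset.Icc 1 (M / (x.1 ^ 2 * x.2 ^ 3)),
        v (x.1 * x.2 ^ 2) := by
    rw [weightedSum_eq_sum, Finset.sum_filter]
    refine Finset.sum_congr rfl fun x hx => ?_
    rw [Finset.mem_product, Finset.mem_Icc, Finset.mem_Icc] at hx
    split_ifs with hsq
    · have h1 : ⌊B / ((x.1 : ℝ) ^ 2 * (x.2 : ℝ) ^ 3)⌋₊ = M / (x.1 ^ 2 * x.2 ^ 3) := by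
        rw [hM, ← Nat.floor_div_natCast]; push_cast; rfl
      rw [Finset.sum_const, Nat.card_Icc, Nat.add_sub_cancel, nsmul_eq_mul,
        ← hF x.1 x.2 hx.1.1 hx.2.1 hsq, weight, h1]
      ring
    · rw [hF0 x.1 x.2 hsq, zero_mul]
  rw [hrhs, Finset.sum_sigma', Finset.sum_sigma']
  symm
  refine Finset.sum_nbij
    (fun y => ⟨y.2 * (y.1.1 ^ 2 * y.1.2 ^ 3), (y.2 * (y.1.1 * y.1.2), y.1.1 * y.1.2 ^ 2)⟩)
    ?_ ?_ ?_ fun _ _ => rfl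
  · rintro ⟨⟨r, s⟩, m⟩ hy
    simp only [Finset.mem_sigma, Finset.mem_filter, Finset.mem_product, Finset.mem_Icc,
      Nat.mem_divisorsAntidiagonal] at hy ⊢
    obtain ⟨⟨⟨⟨hr, -⟩, hs, -⟩, -⟩, hm, hmM⟩ := hy
    have hpos : 0 < r ^ 2 * s ^ 3 := by positivity
    have hpos' : 0 < m * (r ^ 2 * s ^ 3) := by positivity
    exact ⟨⟨hpos', (Nat.le_div_iff_mul_le hpos).1 hmM⟩, ⟨by ring, hpos'.ne'⟩,
      ⟨m ^ 2 * r, by ring⟩⟩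
  · rintro ⟨⟨r, s⟩, m⟩ hy ⟨⟨r', s'⟩, m'⟩ hy' heq
    simp only [Finset.coe_sigma, Set.mem_sigma_iff, Finset.mem_coe, Finset.mem_filter,
      Finset.mem_product, Finset.mem_Icc] at hy hy'
    obtain ⟨⟨⟨⟨hr, -⟩, hs, -⟩, hsq⟩, hm, -⟩ := hy
    obtain ⟨⟨⟨⟨hr', -⟩, hs', -⟩, hsq'⟩, hm', -⟩ := hy'
    simp only [Sigma.mk.injEq, heq_eq_eq, Prod.mk.injEq] at heq
    obtain ⟨-, h1, h2⟩ := heq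
    -- By the previous lemma, rs is the least positive integer whose square is divisible by d, so d
    -- determines it.
    have hrs : r * s = r' * s' := by
      refine Nat.dvd_antisymm ?_ ?_
      · rw [← dvd_sq_iff_of_squarefree hsq hs, h2, dvd_sq_iff_of_squarefree hsq' hs']
      · rw [← dvd_sq_iff_of_squarefree hsq' hs', ← h2, dvd_sq_iff_of_squarefree hsq hs]
    have hss : s = s' := by
      have : r * s * s = r * s * s' := by
        calc r * s * s = r * s ^ 2 := by ring
          _ = r' * s' ^ 2 := h2
          _ = r' * s' * s' := by ring
          _ = r * s * s' := by rw [hrs]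
      exact Nat.eq_of_mul_eq_mul_left (by positivity) this
    subst hss
    obtain rfl := Nat.eq_of_mul_eq_mul_right hs hrs
    obtain rfl := Nat.eq_of_mul_eq_mul_right (by positivity) h1
    rfl
  · rintro ⟨n, a, d⟩ hy
    simp only [Finset.coe_sigma, Set.mem_sigma_iff, Finset.mem_coe, Finset.mem_filter,
      Finset.mem_Icc, Nat.mem_divisorsAntidiagonal] at hy
    obtain ⟨⟨hn1, hnM⟩, ⟨hn, hn0⟩, hda⟩ := hy
    have hd : 0 < d := Nat.pos_of_ne_zero fun h => hn0 (by rw [← hn, h, mul_zero])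
    obtain ⟨r, s, hr, hs, hd', hsq⟩ := Nat.sq_mul_squarefree_of_pos hd
    have hd'' : d = r * s ^ 2 := by rw [← hd', mul_comm]
    subst hd''
    obtain ⟨m, rfl⟩ := (dvd_sq_iff_of_squarefree hsq hs).1 hda
    have hm : 0 < m := Nat.pos_of_ne_zero fun h => hn0 (by rw [← hn, h]; simp)
    have hnm : m * (r ^ 2 * s ^ 3) = n := by rw [← hn]; ring
    have hpos : 0 < r ^ 2 * s ^ 3 := by positivity
    have hle : r ^ 2 * s ^ 3 ≤ M := le_trans (Nat.le_mul_of_pos_left _ hm) (hnm ▸ hnM)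
    have hrM : r ≤ M := le_trans (Nat.le_of_dvd hpos ⟨r * s ^ 3, by ring⟩) hle
    have hsM : s ≤ M := le_trans (Nat.le_of_dvd hpos ⟨r ^ 2 * s ^ 2, by ring⟩) hle
    refine ⟨⟨(r, s), m⟩, ?_, ?_⟩
    · simp only [Finset.coe_sigma, Set.mem_sigma_iff, Finset.mem_coe, Finset.mem_filter,
        Finset.mem_product, Finset.mem_Icc]
      exact ⟨⟨⟨⟨hr, hrM⟩, hs, hsM⟩, hsq⟩, hm, (Nat.le_div_iff_mul_le hpos).2 (hnm ▸ hnM)⟩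
    · simp only [Sigma.mk.injEq, heq_eq_eq, Prod.mk.injEq]
      exact ⟨hnm, by ring, trivial⟩

lemma N_eq_weightedSum (B : ℝ) : (N B : ℝ) = weightedSum (sieveWeight fun _ => 0) B := by
  rw [← sum_divisorsAntidiagonal_eq_weightedSum (v := fun d => (d : ℝ)), N, Nat.cast_sum]
  · refine Finset.sum_congr rfl fun n hn => ?_
    rw [a_eq_sum (by have := (Finset.mem_Icc.1 hn).1; omega), Nat.cast_sum]
  · intro r s _ _ hsq
    simp [sieveWeight, hsq]
  · intro r s hsq
    simp [sieveWeight, hsq]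

/-- φ(d)/d depends only on the primes dividing d, and rs² and rs have the same ones. -/
lemma NCyclic_eq_weightedSum (B : ℝ) :
    (NCyclic B : ℝ) = weightedSum (sieveWeight fun p => (p : ℝ)⁻¹) B := by
  rw [← sum_divisorsAntidiagonal_eq_weightedSum (v := fun d => (d.totient : ℝ)), NCyclic,
    Nat.cast_sum]
  · refine Finset.sum_congr rfl fun n hn => ?_
    rw [aCyclic_eq_sum (by have := (Finset.mem_Icc.1 hn).1; omega), Nat.cast_sum]
  · intro r s hr hs hsq
    have h := congrArg (fun q : ℚ => (q : ℝ)) (Nat.totient_eq_mul_prod_factors (r * s ^ 2))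
    push_cast at h
    have hpf : (r * s ^ 2).primeFactors = (r * s).primeFactors := by
      rw [Nat.primeFactors_mul hr.ne' (by positivity), Nat.primeFactors_mul hr.ne' hs.ne',
        Nat.primeFactors_pow _ two_ne_zero]
    rw [h, hpf, sieveWeight, if_pos hsq, mul_comm]
  · intro r s hsq
    simp [sieveWeight, hsq]

/-! ### Euler products -/

lemma localMean_inv (p : Nat.Primes) :
    localMean (fun p => (p : ℝ)⁻¹) p = eulerFactor p := by
  unfold localMean eulerFactor; ring

lemma summable_eulerFactor_sub_one :
    Summable fun p : Nat.Primes => -3 * ((p : ℕ) : ℝ)⁻¹ ^ 2 + 2 * ((p : ℕ) : ℝ)⁻¹ ^ 3 := by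
  have h3 : Summable fun p : Nat.Primes => ((p : ℕ) : ℝ)⁻¹ ^ 3 := by
    have h := (Real.summable_nat_pow_inv (p := 3)).2 (by norm_num)
    exact (h.comp_injective Nat.Primes.coe_nat_injective).congr fun p => by simp
  exact (summable_primes_inv_sq.mul_left _).add (h3.mul_left _)

lemma eulerFactor_eq (p : Nat.Primes) :
    eulerFactor p = 1 + (-3 * ((p : ℕ) : ℝ)⁻¹ ^ 2 + 2 * ((p : ℕ) : ℝ)⁻¹ ^ 3) := by
  unfold eulerFactor; ring

lemma multipliable_eulerFactor : Multipliable eulerFactor :=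
  (Real.multipliable_one_add_of_summable summable_eulerFactor_sub_one).congr
    fun p => (eulerFactor_eq p).symm

lemma eulerFactor_pos (p : Nat.Primes) : 0 < eulerFactor p := by
  have h1 : ((p : ℕ) : ℝ)⁻¹ < 1 := inv_lt_one_of_one_lt₀ (by exact_mod_cast p.2.one_lt)
  have h0 : 0 < ((p : ℕ) : ℝ)⁻¹ := inv_pos.2 (by exact_mod_cast p.2.pos)
  have e : eulerFactor p = (1 - ((p : ℕ) : ℝ)⁻¹) ^ 2 * (1 + 2 * ((p : ℕ) : ℝ)⁻¹) := by
    unfold eulerFactor; ring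
  rw [e]
  have : 0 < 1 - ((p : ℕ) : ℝ)⁻¹ := by linarith
  positivity

/-- A convergent product of positive factors could still be 0; summability of the logarithms
excludes this. The asymptotic equivalence needs a nonzero constant. -/
lemma tprod_eulerFactor_pos : 0 < ∏' p, eulerFactor p := by
  have h := Real.summable_log_one_add_of_summable summable_eulerFactor_sub_one
  rw [← Real.rexp_tsum_eq_tprod eulerFactor_pos (h.congr fun p => by rw [eulerFactor_eq])]
  exact Real.exp_pos _

/-- Multiplied termwise by the Euler product of ζ(2), this product becomes 1. Taking real parts
gives both the value and the nonvanishing. -/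
lemma hasProd_zeta_two :
    (riemannZeta 2).re ≠ 0 ∧
      HasProd (fun p : Nat.Primes => localMean (fun _ => 0) p) (riemannZeta 2).re⁻¹ := by
  have hm : Multipliable fun p : Nat.Primes => localMean (fun _ => 0) p :=
    (Real.multipliable_one_add_of_summable summable_primes_inv_sq.neg).congr fun p => by
      unfold localMean; ring
  obtain ⟨G, hG⟩ := hm
  have hGc : HasProd (fun p : Nat.Primes => ((localMean (fun _ => 0) p : ℝ) : ℂ)) (G : ℂ) :=
    hG.map Complex.ofRealHom Complex.continuous_ofReal
  have hz := riemannZeta_eulerProduct_hasProd (s := 2) (by norm_num)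
  have h1 := hGc.mul hz
  have e : ∀ p : Nat.Primes,
      ((localMean (fun _ => 0) p : ℝ) : ℂ) * (1 - ((p : ℕ) : ℂ) ^ (-2 : ℂ))⁻¹ = 1 := by
    intro p
    have h2 : ((localMean (fun _ => 0) p : ℝ) : ℂ) = 1 - ((p : ℕ) : ℂ) ^ (-2 : ℂ) := by
      rw [Complex.cpow_neg, Complex.cpow_ofNat]
      simp [localMean]
    have h3 : 0 < localMean (fun _ => 0) p := by
      have h1 : ((p : ℕ) : ℝ)⁻¹ < 1 := inv_lt_one_of_one_lt₀ (by exact_mod_cast p.2.one_lt)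
      have h0 : 0 < ((p : ℕ) : ℝ)⁻¹ := inv_pos.2 (by exact_mod_cast p.2.pos)
      unfold localMean
      nlinarith
    rw [← h2]
    exact mul_inv_cancel₀ (by exact_mod_cast h3.ne')
  have h2 : (G : ℂ) * riemannZeta 2 = 1 := by
    refine h1.unique ?_
    simp only [e]
    exact hasProd_one
  have h3 : G * (riemannZeta 2).re = 1 := by
    have := congrArg Complex.re h2
    simpa using this
  have h4 : (riemannZeta 2).re ≠ 0 := right_ne_zero_of_mul (h3 ▸ one_ne_zero)
  refine ⟨h4, ?_⟩
  rwa [← eq_inv_of_mul_eq_one_left h3]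

end CocyclicSubrings

theorem corollary8 :
    -- the counts and the Euler product are well defined
    (∀ n : ℕ, 1 ≤ n → (CocyclicSubrings.subringsOfIndex n).Finite) ∧
    Multipliable CocyclicSubrings.eulerFactor ∧
    -- the number of cocyclic subrings of index at most `B`
    Asymptotics.IsEquivalent Filter.atTop
      (fun B : ℝ => (CocyclicSubrings.NCyclic B : ℝ))
      (fun B : ℝ =>
        (1 / 12 * ∏' p : Nat.Primes, CocyclicSubrings.eulerFactor p) * B * Real.log B ^ 2) ∧
    -- the proportion of cocyclic subrings among all subrings (`ζ(2)` is real)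
    Filter.Tendsto
      (fun B : ℝ => (CocyclicSubrings.NCyclic B : ℝ) / (CocyclicSubrings.N B : ℝ))
      Filter.atTop
      (nhds ((riemannZeta 2).re * ∏' p : Nat.Primes, CocyclicSubrings.eulerFactor p)) := by
  open CocyclicSubrings in
  have hE := tprod_eulerFactor_pos
  have hcyc : Filter.Tendsto (fun B : ℝ => (NCyclic B : ℝ) / (B * Real.log B ^ 2)) Filter.atTop
      (nhds (1 / 12 * ∏' p, eulerFactor p)) := by
    simp only [NCyclic_eq_weightedSum]
    refine hasDensity_sieveWeight (fun p => ⟨by positivity, le_rfl⟩) ?_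
    simp only [localMean_inv]
    exact multipliable_eulerFactor.hasProd
  obtain ⟨hz, hprod⟩ := hasProd_zeta_two
  have hall : Filter.Tendsto (fun B : ℝ => (N B : ℝ) / (B * Real.log B ^ 2)) Filter.atTop
      (nhds (1 / 12 * (riemannZeta 2).re⁻¹)) := by
    simp only [N_eq_weightedSum]
    exact hasDensity_sieveWeight (fun p => ⟨le_rfl, by positivity⟩) hprod
  have hpos : ∀ᶠ B : ℝ in Filter.atTop, B * Real.log B ^ 2 ≠ 0 := by
    filter_upwards [Filter.eventually_gt_atTop 1] with B hB
    have := Real.log_pos hB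
    positivity
  refine ⟨fun n hn => finite_subringsOfIndex (by omega), multipliable_eulerFactor, ?_, ?_⟩
  · refine Asymptotics.isEquivalent_of_tendsto_one ?_
    have h := hcyc.div_const (1 / 12 * ∏' p, eulerFactor p)
    rw [div_self (by positivity)] at h
    refine h.congr fun B => ?_
    simp only [Pi.div_apply]
    rw [div_div]
    congr 1
    ring
  -- Both counts are normalised by B(log B)², which is nonzero for B > 1 and cancels, as does 1/12.
  · have h := hcyc.div hall (by simpa using hz)
    have e : 1 / 12 * (∏' p, eulerFactor p) / (1 / 12 * (riemannZeta 2).re⁻¹)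
        = (riemannZeta 2).re * ∏' p, eulerFactor p := by field_simp
    rw [e] at h
    refine h.congr' ?_
    filter_upwards [hpos] with B hB
    simp only [Pi.div_apply]
    exact div_div_div_cancel_right₀ hB _ _
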